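/- Let $\mathbb{K}$ be a field, let $G$ be a connected simple graph on $[n]=\{1,\dots,n\}$ that is chordal (every cycle of length at least $4$ has a chord), and let $S=\mathbb{K}[x_1,\dots,x_n,y_1,\dots,y_n]$ with the standard grading. Let $J_G=(x_iy_j-x_jy_i : i<j,\ \{i,j\}\in E(G))\subset S$ be the binomial edge ideal of $G$. For a finitely generated graded $S$-module $M$, the graded Betti number $\beta_{i,j}(M)$ is the number of copies of $S(-j)$ in the $i$-th module $F_i$ of a minimal graded free resolution $\cdots\to F_1\to F_0\to M\to 0$, that is, a graded exact complex of finitely generated graded free modules $F_i$ with $F_{i+1}$ mapped into $(x_1,\dots,x_n,y_1,\dots,y_n)F_i$ for all $i\ge 0$. Then $S/J_G$ has a minimal graded free resolution, and $$\beta_{i,j}(S/J_G)=0\quad\text{for all integers } i\ge 0 \text{ and } j>2i,$$ whichever minimal graded free resolution is used to compute it. -/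

import Mathlib

/-- A simple graph is chordal if every cycle of length at least `4` has a chord, that is, an edge
of the graph which joins two vertices of the cycle and is not an edge of the cycle. -/
def SimpleGraph.IsChordalGraph {V : Type*} (G : SimpleGraph V) : Prop :=
  ∀ (v : V) (c : G.Walk v v), c.IsCycle → 4 ≤ c.length →
    ∃ u ∈ c.support, ∃ w ∈ c.support, G.Adj u w ∧ s(u, w) ∉ c.edges

/-- The polynomial ring `K[x_1, …, x_n, y_1, …, y_n]`; the variable `x_i` is
`MvPolynomial.X (Sum.inl i)` and the variable `y_i` is `MvPolynomial.X (Sum.inr i)`. -/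
abbrev PolyRingXY (K : Type*) [Field K] (n : ℕ) : Type _ := MvPolynomial (Fin n ⊕ Fin n) K

/-- The binomial edge ideal `J_G = (x_i y_j - x_j y_i : i < j, {i, j} ∈ E(G))`. -/
noncomputable def binomialEdgeIdeal (K : Type*) [Field K] {n : ℕ} (G : SimpleGraph (Fin n)) :
    Ideal (PolyRingXY K n) :=
  Ideal.span {f | ∃ i j : Fin n, i < j ∧ G.Adj i j ∧
    f = MvPolynomial.X (Sum.inl i) * MvPolynomial.X (Sum.inr j)
      - MvPolynomial.X (Sum.inl j) * MvPolynomial.X (Sum.inr i)}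

/-- The component of degree `d ∈ ℤ` of the standard graded polynomial ring (every variable has
degree one); it is zero for `d < 0`. -/
def stdGradedPart (K : Type*) [Field K] (σ : Type*) (d : ℤ) : Submodule K (MvPolynomial σ K) where
  carrier := {p | ∀ m : σ →₀ ℕ, MvPolynomial.coeff m p ≠ 0 → ((Finsupp.degree m : ℕ) : ℤ) = d}
  zero_mem' := by intro m hm; simp at hm
  add_mem' := by
    intro p q hp hq m hm
    by_cases h : MvPolynomial.coeff m p = 0
    · exact hq m (by simpa [h] using hm)
    · exact hp m h
  smul_mem' := by
    intro c p hp m hm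
    refine hp m fun h => hm ?_
    simp [h]

/-- The grading of the quotient `R ⧸ I` of the standard graded polynomial ring `R` by a homogeneous
ideal `I`: its component of degree `d` consists of the classes of the forms of degree `d`. -/
noncomputable def quotientGrading {K : Type*} [Field K] {σ : Type*} (I : Ideal (MvPolynomial σ K)) (d : ℤ) :
    Submodule K (MvPolynomial σ K ⧸ I) :=
  (stdGradedPart K σ d).map (Ideal.Quotient.mkₐ K I).toLinearMap

/-- A minimal graded free resolution of a finitely generated graded module `M`, with graded
components `ℳ d`, over the standard graded polynomial ring `R = K[x_s : s ∈ σ]`: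
an exact sequence `⋯ ⟶ F_2 ⟶ F_1 ⟶ F_0 ⟶ M ⟶ 0` in which `F_i = ⨁_a R(-deg i a)` is a graded free
module of finite rank with a homogeneous basis, all maps are graded of degree zero, and
`F_(i+1)` is mapped into `𝔪 F_i`, where `𝔪` is the ideal generated by the variables. -/
structure MinimalGradedFreeResolution {K : Type*} [Field K] {σ : Type*} {M : Type*}
    [AddCommGroup M] [Module K M] [Module (MvPolynomial σ K) M] (ℳ : ℤ → Submodule K M) where
  /-- the rank of `F_i` -/
  rank : ℕ → ℕ
  /-- the degrees of the basis elements of `F_i` -/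
  deg : (i : ℕ) → Fin (rank i) → ℤ
  /-- the differential `F_(i+1) ⟶ F_i` -/
  diff : (i : ℕ) →
    (Fin (rank (i + 1)) → MvPolynomial σ K) →ₗ[MvPolynomial σ K] (Fin (rank i) → MvPolynomial σ K)
  /-- the augmentation `F_0 ⟶ M` -/
  aug : (Fin (rank 0) → MvPolynomial σ K) →ₗ[MvPolynomial σ K] M
  /-- The image of a basis element of degree `deg (i + 1) b` is homogeneous of that degree: its
  coordinate at a basis element of degree `deg i a` is a form of degree
  `deg (i + 1) b - deg i a`. -/
  diff_mem : ∀ i b a, diff i (Pi.single b 1) a ∈ stdGradedPart K σ (deg (i + 1) b - deg i a)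
  aug_mem : ∀ a, aug (Pi.single a 1) ∈ ℳ (deg 0 a)
  aug_surjective : Function.Surjective aug
  exact_zero : Function.Exact (diff 0) aug
  exact_succ : ∀ i, Function.Exact (diff (i + 1)) (diff i)
  /-- All entries of the matrices of the differentials lie in `𝔪`. -/
  minimal : ∀ i b a, diff i (Pi.single b 1) a ∈
    Ideal.span (Set.range (MvPolynomial.X : σ → MvPolynomial σ K))

/-- The graded Betti number `β_{i,j}(M)` as read off from a minimal graded free resolution of `M`:
the number of copies of `R(-j)` in `F_i`. -/
def MinimalGradedFreeResolution.betti {K : Type*} [Field K] {σ : Type*} {M : Type*}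
    [AddCommGroup M] [Module K M] [Module (MvPolynomial σ K) M] {ℳ : ℤ → Submodule K M}
    (F : MinimalGradedFreeResolution (σ := σ) ℳ) (i : ℕ) (j : ℤ) : ℕ :=
  (Finset.univ.filter fun a : Fin (F.rank i) => F.deg i a = j).card

open MvPolynomial

universe u

section

variable {K : Type*} [Field K] {σ : Type*}

/-! ### Homogeneous components indexed by the integers -/

/-! The bound is proved by induction on the graph. By Dirac's lemma a chordal graph with an edge has
a simplicial vertex `u` with a neighbour `v`. Let `f` be the minor of `uv`. Then `J_G = J_{G∖uv} +
(f)`, and the colon ideal `J_{G∖uv} : f` equals `J_H + (x_w, y_w : w ∈ N(u)∖{v})`, where `H` arises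
by isolating `u` and `N(u)∖{v}` and then joining all remaining neighbours of `v`
(`mem_colon_deleteEdges_iff`). The sequence `0 → J_{G∖uv} → J_G → (S/(J_{G∖uv} : f))(-2) → 0` and
the horseshoe lemma raise degrees by two per homological step, so the slope two survives. Both
smaller graphs are chordal: `H` has fewer non-isolated vertices, `G∖uv` has no more of them and
fewer edges. The extra variables are regular and harmless (`HasQuadraticSlope.sup_span_X`).

One inclusion of the colon formula consists of Plücker relations. The other needs `f` to be regular
modulo `J_H`, where `u` is isolated and `v` simplicial. Since `J_G` is the intersection of `J_{G_w}`
and `(x_w, y_w) + J_{G-w}`, this reduces to graphs all of whose vertices are simplicial. These are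
disjoint unions of cliques, and their ideals are prime, being kernels of monomial maps.

Mapping cones need not be minimal, so the induction carries `ResolutionBound`, a bound through an
arbitrary graded resolution. `MinimalGradedFreeResolution.deg_le_of_retract` transfers it to every
minimal one by comparison maps. Existence of a minimal resolution comes from repeatedly taking the
fewest homogeneous generators. Chordality is used in the form `IsPathChordal`, which behaves well
under the three graph operations. -/

theorem monomial_mem_stdGradedPart (m : σ →₀ ℕ) (c : K) :
    monomial m c ∈ stdGradedPart K σ (Finsupp.degree m : ℕ) := by
  classical
  intro m' hm'
  rw [coeff_monomial] at hm'
  split_ifs at hm' with h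
  · rw [h]
  · exact absurd rfl hm'

theorem X_mem_stdGradedPart (s : σ) : (X s : MvPolynomial σ K) ∈ stdGradedPart K σ 1 := by
  have := monomial_mem_stdGradedPart (K := K) (Finsupp.single s 1) 1
  simpa [X] using this

theorem one_mem_stdGradedPart : (1 : MvPolynomial σ K) ∈ stdGradedPart K σ 0 := by
  have := monomial_mem_stdGradedPart (K := K) (0 : σ →₀ ℕ) 1
  simpa using this

theorem mul_mem_stdGradedPart {i j : ℤ} {p q : MvPolynomial σ K} (hp : p ∈ stdGradedPart K σ i)
    (hq : q ∈ stdGradedPart K σ j) : p * q ∈ stdGradedPart K σ (i + j) := by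
  classical
  intro m hm
  rw [coeff_mul] at hm
  obtain ⟨x, hx, hne⟩ := Finset.exists_ne_zero_of_sum_ne_zero hm
  rw [← hp x.1 (left_ne_zero_of_mul hne), ← hq x.2 (right_ne_zero_of_mul hne),
    ← Finset.HasAntidiagonal.mem_antidiagonal.1 hx]
  simp

theorem eq_zero_of_mem_stdGradedPart_neg {d : ℤ} (hd : d < 0) {p : MvPolynomial σ K}
    (hp : p ∈ stdGradedPart K σ d) : p = 0 := by
  ext m
  by_contra h
  have := hp m (by simpa using h)
  omega

/-- The homogeneous component of degree `d ∈ ℤ` of a polynomial. -/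
noncomputable def intComponent (d : ℤ) : MvPolynomial σ K →ₗ[K] MvPolynomial σ K :=
  if 0 ≤ d then homogeneousComponent d.toNat else 0

theorem coeff_intComponent (d : ℤ) (m : σ →₀ ℕ) (p : MvPolynomial σ K) :
    coeff m (intComponent d p) = if ((Finsupp.degree m : ℕ) : ℤ) = d then coeff m p else 0 := by
  classical
  unfold intComponent
  by_cases hd : 0 ≤ d
  · rw [if_pos hd, coeff_homogeneousComponent]
    congr 1
    exact propext ⟨fun h => by omega, fun h => by omega⟩
  · rw [if_neg hd, if_neg (by omega)]
    simp

theorem intComponent_mem (d : ℤ) (p : MvPolynomial σ K) :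
    intComponent d p ∈ stdGradedPart K σ d := by
  intro m hm
  rw [coeff_intComponent] at hm
  by_contra h
  exact hm (if_neg h)

theorem intComponent_of_mem {d : ℤ} {p : MvPolynomial σ K} (hp : p ∈ stdGradedPart K σ d) :
    intComponent d p = p := by
  ext m
  rw [coeff_intComponent]
  split_ifs with h
  · rfl
  · by_contra h'
    exact h (hp m (Ne.symm h'))

theorem intComponent_of_mem_ne {d e : ℤ} (hde : d ≠ e) {p : MvPolynomial σ K}
    (hp : p ∈ stdGradedPart K σ d) : intComponent e p = 0 := by
  ext m
  rw [coeff_intComponent, coeff_zero]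
  split_ifs with h
  · by_contra h'
    exact hde ((hp m h').symm.trans h)
  · rfl

/-- An ideal of the polynomial ring is homogeneous if it contains the components of its elements. -/
def IsHomogeneousIdeal (I : Ideal (MvPolynomial σ K)) : Prop :=
  ∀ p ∈ I, ∀ d, intComponent d p ∈ I

/-! ### Graded free modules -/

section Free

variable {ι : Type*}

/-- The elements of degree `j` in the free module with a basis of elements of degrees `deg a`. -/
def freeGrading (K : Type*) [Field K] {σ : Type*} (deg : ι → ℤ) (j : ℤ) :
    AddSubgroup (ι → MvPolynomial σ K) where
  carrier := {p | ∀ a, p a ∈ stdGradedPart K σ (j - deg a)}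
  zero_mem' _ := zero_mem _
  add_mem' hp hq a := add_mem (hp a) (hq a)
  neg_mem' hp a := neg_mem (hp a)

theorem mem_freeGrading {deg : ι → ℤ} {j : ℤ} {p : ι → MvPolynomial σ K} :
    p ∈ freeGrading K deg j ↔ ∀ a, p a ∈ stdGradedPart K σ (j - deg a) :=
  Iff.rfl

theorem single_mem_freeGrading [DecidableEq ι] (deg : ι → ℤ) (a : ι) :
    (Pi.single a 1 : ι → MvPolynomial σ K) ∈ freeGrading K deg (deg a) := by
  intro b
  by_cases h : b = a
  · subst h
    simpa using one_mem_stdGradedPart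
  · rw [Pi.single_eq_of_ne h]
    exact zero_mem _

/-- The component of degree `j` of an element of a graded free module. -/
noncomputable def freeComponent (deg : ι → ℤ) (j : ℤ) :
    (ι → MvPolynomial σ K) →+ (ι → MvPolynomial σ K) where
  toFun p a := intComponent (j - deg a) (p a)
  map_zero' := by ext1 a; simp
  map_add' p q := by ext1 a; simp

theorem freeComponent_apply (deg : ι → ℤ) (j : ℤ) (p : ι → MvPolynomial σ K) (a : ι) :
    freeComponent deg j p a = intComponent (j - deg a) (p a) := rfl

theorem freeComponent_mem (deg : ι → ℤ) (j : ℤ) (p : ι → MvPolynomial σ K) :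
    freeComponent deg j p ∈ freeGrading K deg j :=
  fun _ => intComponent_mem _ _

theorem freeComponent_of_mem {deg : ι → ℤ} {j : ℤ} {p : ι → MvPolynomial σ K}
    (hp : p ∈ freeGrading K deg j) : freeComponent deg j p = p :=
  funext fun a => intComponent_of_mem (hp a)

theorem freeComponent_of_mem_ne {deg : ι → ℤ} {i j : ℤ} (hij : i ≠ j) {p : ι → MvPolynomial σ K}
    (hp : p ∈ freeGrading K deg i) : freeComponent deg j p = 0 :=
  funext fun a => intComponent_of_mem_ne (by simpa using hij) (hp a)

/-- Only finitely many degrees occur in the coordinates. Allowing every larger `T'` lets a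
prescribed degree be inserted into the sum. -/
theorem exists_sum_freeComponent [Fintype ι] (deg : ι → ℤ) (p : ι → MvPolynomial σ K) :
    ∃ T : Finset ℤ, ∀ T', T ⊆ T' → ∑ j ∈ T', freeComponent deg j p = p := by
  classical
  refine ⟨Finset.univ.biUnion fun a => (p a).support.image
    fun m => ((Finsupp.degree m : ℕ) : ℤ) + deg a, fun T' hT => ?_⟩
  ext a m
  rw [Finset.sum_apply, coeff_sum]
  simp only [freeComponent_apply, coeff_intComponent]
  by_cases h : coeff m (p a) = 0
  · simp [h]
  · have : ((Finsupp.degree m : ℕ) : ℤ) + deg a ∈ T' := hT (by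
      simp only [Finset.mem_biUnion, Finset.mem_image]
      exact ⟨a, Finset.mem_univ _, m, by simpa using h, rfl⟩)
    rw [Finset.sum_eq_single_of_mem _ this]
    · simp
    · intro b _ hb
      rw [if_neg]
      omega

end Free

/-- Multiplication by a form of degree `i` raises the degree by `i`. -/
def GradedSMul {M : Type*} [AddCommGroup M] [Module (MvPolynomial σ K) M]
    (gr : ℤ → AddSubgroup M) : Prop :=
  ∀ (i j : ℤ) (p : MvPolynomial σ K) (m : M), p ∈ stdGradedPart K σ i → m ∈ gr j →
    p • m ∈ gr (i + j)

theorem gradedSMul_free {ι : Type*} (deg : ι → ℤ) :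
    GradedSMul (K := K) (σ := σ) (freeGrading K (σ := σ) deg) := by
  intro i j p m hp hm a
  have := mul_mem_stdGradedPart hp (hm a)
  rwa [← add_sub_assoc] at this

section

variable {M : Type*} [AddCommGroup M] [Module (MvPolynomial σ K) M]

/-- The grading induced on a submodule. -/
noncomputable def subGrading (N : Submodule (MvPolynomial σ K) M) (gr : ℤ → AddSubgroup M) (j : ℤ) :
    AddSubgroup N :=
  (gr j).comap N.subtype.toAddMonoidHom

theorem mem_subGrading {N : Submodule (MvPolynomial σ K) M} {gr : ℤ → AddSubgroup M} {j : ℤ}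
    {x : N} : x ∈ subGrading N gr j ↔ (x : M) ∈ gr j := Iff.rfl

theorem GradedSMul.sub {gr : ℤ → AddSubgroup M} (h : GradedSMul (K := K) (σ := σ) gr)
    (N : Submodule (MvPolynomial σ K) M) : GradedSMul (K := K) (σ := σ) (subGrading N gr) :=
  fun i j p m hp hm => h i j p m hp hm

theorem GradedSMul.linearCombination_mem {gr : ℤ → AddSubgroup M}
    (h : GradedSMul (K := K) (σ := σ) gr) {ι : Type*} [Fintype ι] {deg : ι → ℤ} {v : ι → M}
    (hv : ∀ a, v a ∈ gr (deg a)) {j : ℤ} {p : ι → MvPolynomial σ K}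
    (hp : p ∈ freeGrading K deg j) :
    Fintype.linearCombination (MvPolynomial σ K) v p ∈ gr j := by
  rw [Fintype.linearCombination_apply]
  refine sum_mem fun a _ => ?_
  have := h _ _ _ _ (hp a) (hv a)
  rwa [sub_add_cancel] at this

theorem linearMap_eq_linearCombination {ι : Type*} [Fintype ι] [DecidableEq ι]
    (φ : (ι → MvPolynomial σ K) →ₗ[MvPolynomial σ K] M) :
    φ = Fintype.linearCombination (MvPolynomial σ K) fun a => φ (Pi.single a 1) := by
  apply (Pi.basisFun (MvPolynomial σ K) ι).ext
  intro a
  rw [Pi.basisFun_apply, Fintype.linearCombination_apply_single, one_smul]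

theorem GradedSMul.map_mem {gr : ℤ → AddSubgroup M}
    (h : GradedSMul (K := K) (σ := σ) gr) {ι : Type*} [Fintype ι] [DecidableEq ι] {deg : ι → ℤ}
    {φ : (ι → MvPolynomial σ K) →ₗ[MvPolynomial σ K] M}
    (hv : ∀ a, φ (Pi.single a 1) ∈ gr (deg a)) {j : ℤ} {p : ι → MvPolynomial σ K}
    (hp : p ∈ freeGrading K deg j) : φ p ∈ gr j := by
  rw [linearMap_eq_linearCombination φ]
  exact h.linearCombination_mem hv hp

end

/-- Homogeneous maps between graded free modules commute with taking components. -/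
theorem map_freeComponent {ι κ : Type*} [Fintype ι] [DecidableEq ι] {deg : ι → ℤ}
    {deg' : κ → ℤ}
    {φ : (ι → MvPolynomial σ K) →ₗ[MvPolynomial σ K] (κ → MvPolynomial σ K)}
    (hv : ∀ a, φ (Pi.single a 1) ∈ freeGrading K deg' (deg a)) (j : ℤ)
    (p : ι → MvPolynomial σ K) :
    φ (freeComponent deg j p) = freeComponent deg' j (φ p) := by
  obtain ⟨T, hT⟩ := exists_sum_freeComponent deg p
  have h := hT (insert j T) (Finset.subset_insert _ _)
  have hmem : ∀ i, φ (freeComponent deg i p) ∈ freeGrading K deg' i := fun i =>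
    (gradedSMul_free deg').map_mem hv (freeComponent_mem _ _ _)
  conv_rhs => rw [← h]
  rw [map_sum, map_sum, Finset.sum_eq_single_of_mem j (Finset.mem_insert_self _ _)]
  · exact (freeComponent_of_mem (hmem j)).symm
  · intro i _ hij
    exact freeComponent_of_mem_ne hij (hmem i)

end

/-! ### Degree bounds through arbitrary graded resolutions -/

section

/-- The graded module `M` has a graded free resolution whose first `n` terms `F_0, …, F_(n-1)` have
finite rank and are such that `F_i` is generated in degrees at most `d i`. -/
def ResolutionBound (K : Type u) [Field K] (σ : Type) : (n : ℕ) → (d : ℕ → ℤ) → (M : Type u) →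
    [AddCommGroup M] → [Module (MvPolynomial σ K) M] → (gr : ℤ → AddSubgroup M) → Prop
  | 0, _, _, _, _, _ => True
  | n + 1, d, M, _, _, gr => ∃ (ι : Type) (_ : Fintype ι) (deg : ι → ℤ) (v : ι → M),
      (∀ a, deg a ≤ d 0) ∧ (∀ a, v a ∈ gr (deg a)) ∧
      (∀ j, ∀ m ∈ gr j, ∃ p ∈ freeGrading K deg j,
        Fintype.linearCombination (MvPolynomial σ K) v p = m) ∧
      ResolutionBound K σ n (fun i => d (i + 1))
        (LinearMap.ker (Fintype.linearCombination (MvPolynomial σ K) v))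
        (subGrading _ (freeGrading K deg))

variable {K : Type u} [Field K] {σ : Type}

/-- The same generators and relations serve after an isomorphism of degree `s`. The shift is needed
where the kernel of `R(-e) → B/I` is identified with a colon ideal. -/
theorem ResolutionBound.transfer (n : ℕ) : ∀ {d d' : ℕ → ℤ} {M M' : Type u} [AddCommGroup M]
    [Module (MvPolynomial σ K) M] [AddCommGroup M'] [Module (MvPolynomial σ K) M']
    {gr : ℤ → AddSubgroup M} {gr' : ℤ → AddSubgroup M'} (e : M ≃ₗ[MvPolynomial σ K] M') (s : ℤ)
    (_ : ∀ j m, m ∈ gr j ↔ e m ∈ gr' (j + s)) (_ : ∀ i, d i + s ≤ d' i)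
    (_ : ResolutionBound K σ n d M gr), ResolutionBound K σ n d' M' gr' := by
  induction n with
  | zero => intros; trivial
  | succ n ih =>
    rintro d d' M M' _ _ _ _ gr gr' e s hg hd ⟨ι, _, deg, v, h0, hv, hs, hr⟩
    have key : Fintype.linearCombination (MvPolynomial σ K) (fun a => e (v a)) =
        e.toLinearMap ∘ₗ Fintype.linearCombination (MvPolynomial σ K) v := by
      ext p
      simp [Fintype.linearCombination_apply]
    have hgr : ∀ j (p : ι → MvPolynomial σ K), p ∈ freeGrading K deg j ↔
        p ∈ freeGrading K (fun a => deg a + s) (j + s) := by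
      intro j p
      simp [mem_freeGrading]
    refine ⟨ι, inferInstance, fun a => deg a + s, fun a => e (v a), fun a => ?_,
      fun a => (hg _ _).1 (hv a), fun j m hm => ?_, ?_⟩
    · have := h0 a
      have := hd 0
      linarith
    · obtain ⟨p, hp, hpm⟩ := hs (j - s) (e.symm m) ((hg _ _).2 (by simpa using hm))
      refine ⟨p, by simpa using (hgr _ _).1 hp, ?_⟩
      rw [key]
      simp [hpm]
    · refine ih (LinearEquiv.ofEq _ _ ?_) s (fun j m => ?_) (fun i => hd (i + 1)) hr
      · rw [key, LinearEquiv.ker_comp]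
      · simpa only [mem_subGrading, LinearEquiv.coe_ofEq_apply] using hgr j m

theorem ResolutionBound.of_subsingleton (n : ℕ) : ∀ (d : ℕ → ℤ) (M : Type u) [AddCommGroup M]
    [Module (MvPolynomial σ K) M] (gr : ℤ → AddSubgroup M) [Subsingleton M],
    ResolutionBound K σ n d M gr := by
  induction n with
  | zero => intros; trivial
  | succ n ih =>
    intro d M _ _ gr _
    exact ⟨Empty, inferInstance, Empty.elim, Empty.elim, fun a => a.elim, fun a => a.elim,
      fun j m _ => ⟨0, zero_mem _, Subsingleton.elim _ _⟩, ih _ _ _⟩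

theorem ResolutionBound.free (n : ℕ) {ι : Type} [Fintype ι] (d : ℕ → ℤ) (deg : ι → ℤ)
    (hd : ∀ a, deg a ≤ d 0) :
    ResolutionBound K σ n d (ι → MvPolynomial σ K) (freeGrading K deg) := by
  classical
  cases n with
  | zero => trivial
  | succ n =>
    have key : Fintype.linearCombination (MvPolynomial σ K)
        (fun a : ι => (Pi.single a 1 : ι → MvPolynomial σ K)) = LinearMap.id :=
      (linearMap_eq_linearCombination LinearMap.id).symm
    refine ⟨ι, inferInstance, deg, fun a => Pi.single a 1, hd, single_mem_freeGrading deg,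
      fun j m hm => ⟨m, hm, by rw [key]; rfl⟩, ?_⟩
    have : Subsingleton (LinearMap.ker (Fintype.linearCombination (MvPolynomial σ K)
        (fun a : ι => (Pi.single a 1 : ι → MvPolynomial σ K)))) := by
      rw [key, LinearMap.ker_id]
      infer_instance
    exact .of_subsingleton _ _ _ _

theorem linearCombination_sumElim {ι κ M : Type*} [Fintype ι] [Fintype κ] [AddCommGroup M]
    [Module (MvPolynomial σ K) M] (v : ι → M) (w : κ → M) (p : ι ⊕ κ → MvPolynomial σ K) :
    Fintype.linearCombination (MvPolynomial σ K) (Sum.elim v w) p =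
      Fintype.linearCombination (MvPolynomial σ K) v (fun a => p (Sum.inl a)) +
      Fintype.linearCombination (MvPolynomial σ K) w (fun a => p (Sum.inr a)) := by
  simp [Fintype.linearCombination_apply]

/-- The horseshoe lemma: bounds for the ends of a short exact sequence bound the middle. -/
theorem ResolutionBound.horseshoe (n : ℕ) : ∀ {d : ℕ → ℤ} {A B C : Type u} [AddCommGroup A]
    [Module (MvPolynomial σ K) A] [AddCommGroup B] [Module (MvPolynomial σ K) B] [AddCommGroup C]
    [Module (MvPolynomial σ K) C] {gA : ℤ → AddSubgroup A} {gB : ℤ → AddSubgroup B}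
    {gC : ℤ → AddSubgroup C} (_ : GradedSMul (K := K) (σ := σ) gB)
    (f : A →ₗ[MvPolynomial σ K] B) (g : B →ₗ[MvPolynomial σ K] C) (_ : Function.Injective f)
    (_ : ∀ a, g (f a) = 0) (_ : ∀ j, ∀ a ∈ gA j, f a ∈ gB j) (_ : ∀ j, ∀ b ∈ gB j, g b ∈ gC j)
    (_ : ∀ j, ∀ b ∈ gB j, g b = 0 → ∃ a ∈ gA j, f a = b)
    (_ : ∀ j, ∀ c ∈ gC j, ∃ b ∈ gB j, g b = c)
    (_ : ResolutionBound K σ n d A gA) (_ : ResolutionBound K σ n d C gC), ResolutionBound K σ n d B gB := by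
  induction n with
  | zero => intros; trivial
  | succ n ih =>
    rintro d A B C _ _ _ _ _ _ gA gB gC hB f g hf hgf hfA hgB hex hsurj
      ⟨ι, _, degA, vA, hdA, hvA, hsA, hrA⟩ ⟨κ, _, degC, vC, hdC, hvC, hsC, hrC⟩
    -- Generators of `C` are lifted to `B`; together with those of `A` they generate `B`.
    choose vB hvB hgvB using fun c => hsurj _ _ (hvC c)
    have hlc : ∀ p, Fintype.linearCombination (MvPolynomial σ K) (Sum.elim (fun a => f (vA a)) vB) p
        = f (Fintype.linearCombination (MvPolynomial σ K) vA fun a => p (Sum.inl a)) +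
          Fintype.linearCombination (MvPolynomial σ K) vB fun c => p (Sum.inr c) := by
      intro p
      rw [linearCombination_sumElim]
      simp [Fintype.linearCombination_apply]
    have hglc : ∀ p, g (Fintype.linearCombination (MvPolynomial σ K) vB p) =
        Fintype.linearCombination (MvPolynomial σ K) vC p := by
      intro p
      simp [Fintype.linearCombination_apply, hgvB]
    have hgr : ∀ j (p : ι ⊕ κ → MvPolynomial σ K), p ∈ freeGrading K (Sum.elim degA degC) j ↔
        (fun a => p (Sum.inl a)) ∈ freeGrading K degA j ∧
        (fun c => p (Sum.inr c)) ∈ freeGrading K degC j := by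
      intro j p
      simp [mem_freeGrading]
    have hvB' : ∀ x : ι ⊕ κ, Sum.elim (fun a => f (vA a)) vB x ∈ gB (Sum.elim degA degC x) := by
      rintro (a | c)
      · exact hfA _ _ (hvA a)
      · exact hvB c
    refine ⟨ι ⊕ κ, inferInstance, Sum.elim degA degC, Sum.elim (fun a => f (vA a)) vB, ?_, hvB',
      fun j b hb => ?_, ?_⟩
    · rintro (a | c)
      · exact hdA a
      · exact hdC c
    · obtain ⟨pC, hpC, hpCb⟩ := hsC j (g b) (hgB _ _ hb)
      obtain ⟨a, ha, hab⟩ := hex j (b - Fintype.linearCombination (MvPolynomial σ K) vB pC)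
        (sub_mem hb (hB.linearCombination_mem hvB hpC)) (by rw [map_sub, hglc, hpCb, sub_self])
      obtain ⟨pA, hpA, hpAa⟩ := hsA j a ha
      refine ⟨Sum.elim pA pC, (hgr _ _).2 ⟨hpA, hpC⟩, ?_⟩
      rw [hlc]
      simp [hpAa, hab]
    -- The first syzygies again form a short exact sequence, so the induction hypothesis applies to
    -- the three kernels.
    · let E := LinearEquiv.sumArrowLequivProdArrow ι κ (MvPolynomial σ K) (MvPolynomial σ K)
      let F : (ι → MvPolynomial σ K) →ₗ[MvPolynomial σ K] (ι ⊕ κ → MvPolynomial σ K) :=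
        E.symm.toLinearMap ∘ₗ LinearMap.inl _ _ _
      let G : (ι ⊕ κ → MvPolynomial σ K) →ₗ[MvPolynomial σ K] (κ → MvPolynomial σ K) :=
        LinearMap.snd _ _ _ ∘ₗ E.toLinearMap
      have hFl : ∀ p, (fun a => F p (Sum.inl a)) = p := fun p => rfl
      have hFr : ∀ p, (fun a => F p (Sum.inr a)) = 0 := fun p => rfl
      have hG : ∀ p, G p = fun c => p (Sum.inr c) := fun p => rfl
      have hF' : ∀ p ∈ LinearMap.ker (Fintype.linearCombination (MvPolynomial σ K) vA),
          F p ∈ LinearMap.ker (Fintype.linearCombination (MvPolynomial σ K)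
            (Sum.elim (fun a => f (vA a)) vB)) := by
        intro p hp
        rw [LinearMap.mem_ker] at hp ⊢
        rw [hlc, hFl, hFr, hp]
        simp
      have hG' : ∀ p ∈ LinearMap.ker (Fintype.linearCombination (MvPolynomial σ K)
            (Sum.elim (fun a => f (vA a)) vB)),
          G p ∈ LinearMap.ker (Fintype.linearCombination (MvPolynomial σ K) vC) := by
        intro p hp
        rw [LinearMap.mem_ker] at hp ⊢
        rw [hlc] at hp
        rw [hG, ← hglc]
        have := congrArg g hp
        rwa [map_add, hgf, zero_add, map_zero] at this
      refine ih ((gradedSMul_free _).sub _) (F.restrict hF') (G.restrict hG') ?_ ?_ ?_ ?_ ?_ ?_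
        hrA hrC
      · intro p q hpq
        have h := congrArg Subtype.val hpq
        have h' : F p = F q := h
        ext1
        rw [← hFl p, ← hFl q, h']
      · intro p
        rfl
      · intro j p hp
        refine (hgr _ _).2 ⟨hp, ?_⟩
        exact zero_mem (freeGrading K degC j)
      · intro j p hp
        exact ((hgr _ _).1 hp).2
      · rintro j ⟨p, hp⟩ hpj hp0
        have h0 : (fun c => p (Sum.inr c)) = 0 := congrArg Subtype.val hp0
        rw [LinearMap.mem_ker, hlc, h0, map_zero, add_zero] at hp
        refine ⟨⟨fun a => p (Sum.inl a), hf (by rw [hp, map_zero])⟩, ((hgr _ _).1 hpj).1, ?_⟩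
        ext1
        funext x
        rcases x with a | c
        · rfl
        · exact (congrFun h0 c).symm
      · rintro j ⟨p, hp⟩ hpj
        have hp0 : Fintype.linearCombination (MvPolynomial σ K) vC p = 0 := hp
        have hpj' : p ∈ freeGrading K degC j := hpj
        -- A relation among the generators of `C` lifts to an element of `A`; subtracting an
        -- expression of it in the generators of `A` gives a relation in `B`.
        obtain ⟨a, ha, hab⟩ := hex j _ (hB.linearCombination_mem hvB hpj') (by rw [hglc, hp0])
        obtain ⟨pA, hpA, hpAa⟩ := hsA j a ha
        refine ⟨⟨Sum.elim (-pA) p, ?_⟩, (hgr _ _).2 ⟨neg_mem hpA, hpj⟩, rfl⟩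
        rw [LinearMap.mem_ker, hlc]
        simp only [Sum.elim_inl, Sum.elim_inr, Pi.neg_apply]
        change f (Fintype.linearCombination (MvPolynomial σ K) vA (-pA)) + _ = 0
        rw [map_neg, hpAa, map_neg, hab]
        exact neg_add_cancel _

/-- The standard grading of the polynomial ring. -/
noncomputable def polyGrading (K : Type*) [Field K] (σ : Type*) (j : ℤ) : AddSubgroup (MvPolynomial σ K) :=
  (stdGradedPart K σ j).toAddSubgroup

theorem gradedSMul_polyGrading : GradedSMul (K := K) (σ := σ) (polyGrading K σ) :=
  fun _ _ _ _ hp hm => mul_mem_stdGradedPart hp hm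

/-- Multiplication by `f` is a homogeneous map `R(-e) → R` of free modules of rank one, so it
commutes with components. -/
theorem intComponent_mul_of_mem {e : ℤ} {f : MvPolynomial σ K} (hf : f ∈ stdGradedPart K σ e)
    (t : MvPolynomial σ K) (j : ℤ) :
    intComponent j (t * f) = intComponent (j - e) t * f := by
  have h := map_freeComponent (K := K) (σ := σ) (deg := fun _ : Unit => e)
    (deg' := fun _ : Unit => (0 : ℤ))
    (φ := LinearMap.pi fun _ => (LinearMap.toSpanSingleton _ _ f) ∘ₗ LinearMap.proj ())
    (fun a b => by simpa using hf) j (fun _ => t)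
  have := congrFun h ()
  simpa [freeComponent_apply] using this.symm

/-- Adding a form to an ideal: the mapping cone of multiplication by the form. -/
theorem ResolutionBound.sup_span_singleton {n : ℕ} {d d' : ℕ → ℤ} {e : ℤ}
    {I L : Ideal (MvPolynomial σ K)} {f : MvPolynomial σ K} (hI : IsHomogeneousIdeal I)
    (hf : f ∈ stdGradedPart K σ e) (hL : ∀ s, s ∈ L ↔ s * f ∈ I) (he : e ≤ d 0)
    (hd : ∀ i, d' i + e ≤ d (i + 1))
    (hIr : ResolutionBound K σ (n + 1) d I (subGrading I (polyGrading K σ)))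
    (hLr : ResolutionBound K σ n d' L (subGrading L (polyGrading K σ))) :
    ResolutionBound K σ (n + 1) d (I ⊔ Ideal.span {f} : Ideal (MvPolynomial σ K))
      (subGrading _ (polyGrading K σ)) := by
  set B : Ideal (MvPolynomial σ K) := I ⊔ Ideal.span {f} with hB
  have hfB : f ∈ B := Ideal.mem_sup_right (Ideal.mem_span_singleton_self f)
  let g := I.mkQ.submoduleMap B
  have hg0 : ∀ b : B, g b = 0 ↔ (b : MvPolynomial σ K) ∈ I := by
    intro b
    rw [← Submodule.Quotient.mk_eq_zero I, ← Submodule.mkQ_apply]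
    exact ⟨fun h => congrArg Subtype.val h, fun h => Subtype.ext h⟩
  -- The horseshoe is applied to `I → B → B/I`, with the image grading on `B/I`. This quotient is
  -- cyclic, generated in degree `e` by the class of `f`, with relation ideal `L`.
  let gC : ℤ → AddSubgroup (Submodule.map I.mkQ B) := fun j =>
    (subGrading B (polyGrading K σ) j).map g.toAddMonoidHom
  refine .horseshoe (gC := gC) _ (gradedSMul_polyGrading.sub _)
    (Submodule.inclusion (le_sup_left : I ≤ B)) g (Submodule.inclusion_injective _) (fun a => ?_)
    (fun j a ha => ha) (fun j b hb => ⟨b, hb, rfl⟩) (fun j b hb h0 => ?_) (fun j c hc => ?_) hIr ?_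
  · exact (hg0 _).2 a.2
  · exact ⟨⟨b, (hg0 b).1 h0⟩, hb, rfl⟩
  · obtain ⟨b, hb, rfl⟩ := hc
    exact ⟨b, hb, rfl⟩
  · have hlc : ∀ p : Unit → MvPolynomial σ K, Fintype.linearCombination (MvPolynomial σ K)
        (fun _ : Unit => g ⟨f, hfB⟩) p = g ⟨p () * f, B.mul_mem_left _ hfB⟩ := by
      intro p
      rw [Fintype.linearCombination_apply, Fintype.sum_unique, ← map_smul]
      rfl
    refine ⟨Unit, inferInstance, fun _ => e, fun _ => g ⟨f, hfB⟩, fun _ => he,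
      fun _ => ⟨⟨f, hfB⟩, hf, rfl⟩, fun j c hc => ?_, ?_⟩
    · obtain ⟨⟨b, hbB⟩, hb, rfl⟩ := hc
      obtain ⟨i, hi, s, hs, hsum⟩ := Submodule.mem_sup.1 hbB
      obtain ⟨t, rfl⟩ := Ideal.mem_span_singleton'.1 hs
      have hb' : b ∈ stdGradedPart K σ j := hb
      refine ⟨fun _ => intComponent (j - e) t, fun _ => intComponent_mem _ _, ?_⟩
      rw [hlc]
      refine (sub_eq_zero.1 ?_).symm
      change g ⟨b, hbB⟩ - _ = 0
      rw [← map_sub, hg0]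
      have : b = intComponent j i + intComponent (j - e) t * f := by
        rw [← intComponent_mul_of_mem hf, ← map_add, hsum, intComponent_of_mem hb']
      simpa [this] using hI i hi j
    · have hker : ∀ p : Unit → MvPolynomial σ K, p ∈ LinearMap.ker (Fintype.linearCombination
          (MvPolynomial σ K) (fun _ : Unit => g ⟨f, hfB⟩)) ↔ p () ∈ L := by
        intro p
        rw [LinearMap.mem_ker, hlc, hg0, hL]
      let E : L ≃ₗ[MvPolynomial σ K] LinearMap.ker (Fintype.linearCombination
          (MvPolynomial σ K) (fun _ : Unit => g ⟨f, hfB⟩)) :=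
        { toFun := fun s => ⟨fun _ => s, (hker _).2 s.2⟩
          invFun := fun p => ⟨p.1 (), (hker _).1 p.2⟩
          map_add' := fun _ _ => rfl
          map_smul' := fun _ _ => rfl
          left_inv := fun _ => rfl
          right_inv := fun _ => rfl }
      refine hLr.transfer _ E e (fun j m => ?_) hd
      constructor
      · intro h _
        rw [add_sub_cancel_right]
        exact h
      · intro h
        have := h ()
        rwa [add_sub_cancel_right] at this

end

/-! ### Minimal resolutions obey every such bound -/

section

variable {K : Type u} [Field K] {σ : Type}

theorem one_notMem_span_X :
    (1 : MvPolynomial σ K) ∉ Ideal.span (Set.range (X : σ → MvPolynomial σ K)) := by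
  intro h
  have hle : Ideal.span (Set.range (X : σ → MvPolynomial σ K)) ≤
      RingHom.ker (constantCoeff : MvPolynomial σ K →+* K) := by
    rw [Ideal.span_le]
    rintro _ ⟨s, rfl⟩
    simp
  have := hle h
  simp at this

/-- Coordinates of elements of `𝔞 F`, where `F` is spanned by elements with coordinates in `𝔞`. -/
theorem map_apply_mem_ideal {ι κ : Type*} [Fintype ι] [DecidableEq ι]
    {φ : (ι → MvPolynomial σ K) →ₗ[MvPolynomial σ K] (κ → MvPolynomial σ K)}
    {𝔞 : Ideal (MvPolynomial σ K)} (h : ∀ b a, φ (Pi.single b 1) a ∈ 𝔞)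
    (p : ι → MvPolynomial σ K) (a : κ) : φ p a ∈ 𝔞 := by
  rw [linearMap_eq_linearCombination φ, Fintype.linearCombination_apply, Finset.sum_apply]
  exact sum_mem fun b _ => 𝔞.mul_mem_left _ (h b a)

namespace MinimalGradedFreeResolution

variable {M : Type*} [AddCommGroup M] [Module K M] [Module (MvPolynomial σ K) M]
  {ℳ : ℤ → Submodule K M}

/-- If `N` is a graded retract of a module with a bounded graded resolution, then the first syzygy
module of `N` in a minimal resolution is again one. -/
theorem retract_step (F : MinimalGradedFreeResolution (σ := σ) ℳ) (n : ℕ)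
    {d : ℕ → ℤ} (hmono : Monotone d) (i : ℕ) {N N' : Type u} [AddCommGroup N]
    [Module (MvPolynomial σ K) N] [AddCommGroup N'] [Module (MvPolynomial σ K) N']
    {gN : ℤ → AddSubgroup N} {gN' : ℤ → AddSubgroup N'}
    (ε : (Fin (F.rank i) → MvPolynomial σ K) →ₗ[MvPolynomial σ K] N)
    (hε : ∀ j, ∀ p ∈ freeGrading K (F.deg i) j, ε p ∈ gN j)
    (hεs : ∀ j, ∀ m ∈ gN j, ∃ p ∈ freeGrading K (F.deg i) j, ε p = m)
    (hex : Function.Exact (F.diff i) ε)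
    (r : N →ₗ[MvPolynomial σ K] N') (s : N' →ₗ[MvPolynomial σ K] N) (hsr : ∀ x, s (r x) = x)
    (hr : ∀ j, ∀ m ∈ gN j, r m ∈ gN' j) (hs : ∀ j, ∀ m ∈ gN' j, s m ∈ gN j)
    (hN' : ResolutionBound K σ (n + 1) d N' gN') :
    (∀ a, F.deg i a ≤ d 0) ∧
    ∃ (Q : Type u) (_ : AddCommGroup Q) (_ : Module (MvPolynomial σ K) Q)
      (gQ : ℤ → AddSubgroup Q)
      (r' : LinearMap.ker ε →ₗ[MvPolynomial σ K] Q) (s' : Q →ₗ[MvPolynomial σ K] LinearMap.ker ε),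
      (∀ x, s' (r' x) = x) ∧
      (∀ j, ∀ m ∈ subGrading (LinearMap.ker ε) (freeGrading K (F.deg i)) j, r' m ∈ gQ j) ∧
      (∀ j, ∀ m ∈ gQ j, s' m ∈ subGrading (LinearMap.ker ε) (freeGrading K (F.deg i)) j) ∧
      ResolutionBound K σ n (fun i => d (i + 1)) Q gQ := by
  classical
  obtain ⟨ι, _, degP, v, hdP, hv, hvs, hK⟩ := hN'
  set φ := Fintype.linearCombination (MvPolynomial σ K) v with hφ
  -- Comparison maps: `α` lifts `r ∘ ε` through `φ`, and `β` lifts `s ∘ φ` through `ε`. Hence `β ∘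
  -- α` lifts the identity of `N`.
  choose α₀ hα₀ hα₀' using fun a =>
    hvs _ _ (hr _ _ (hε _ _ (single_mem_freeGrading (K := K) (σ := σ) (F.deg i) a)))
  choose β₀ hβ₀ hβ₀' using fun a => hεs _ _ (hs _ _ (hv a))
  set α := Fintype.linearCombination (MvPolynomial σ K) α₀ with hα
  set β := Fintype.linearCombination (MvPolynomial σ K) β₀ with hβ
  have hφα : ∀ p, φ (α p) = r (ε p) := by
    have : φ ∘ₗ α = r ∘ₗ ε := by
      apply (Pi.basisFun (MvPolynomial σ K) (Fin (F.rank i))).ext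
      intro a
      simp [hα, hα₀', Fintype.linearCombination_apply_single]
    exact fun p => congrArg (fun f => f p) this
  have hεβ : ∀ p, ε (β p) = s (φ p) := by
    have : ε ∘ₗ β = s ∘ₗ φ := by
      apply (Pi.basisFun (MvPolynomial σ K) ι).ext
      intro a
      simp [hβ, hφ, hβ₀', Fintype.linearCombination_apply_single]
    exact fun p => congrArg (fun f => f p) this
  have hαg : ∀ j, ∀ p ∈ freeGrading K (F.deg i) j, α p ∈ freeGrading K degP j :=
    fun j p hp => (gradedSMul_free degP).linearCombination_mem hα₀ hp
  have hβg : ∀ j, ∀ p ∈ freeGrading K degP j, β p ∈ freeGrading K (F.deg i) j :=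
    fun j p hp => (gradedSMul_free (F.deg i)).linearCombination_mem hβ₀ hp
  have hβα : ∀ p, ε (p - β (α p)) = 0 := by
    intro p
    rw [map_sub, hεβ, hφα, hsr, sub_self]
  have hdeg : ∀ a, F.deg i a ≤ d 0 := by
    intro a
    by_contra hlt
    -- The element `e_a - β (α e_a)` lies in the image of the differential, hence in `𝔪 F_i` by
    -- minimality.
    obtain ⟨q, hq⟩ := (hex _).1 (hβα (Pi.single a 1))
    have hmem := map_apply_mem_ideal (F.minimal i) q a
    rw [hq, Pi.sub_apply, Pi.single_eq_same] at hmem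
    -- The generators `β₀ b` have degree at most `d 0 < deg a`, so their coordinates at `a` have
    -- negative degree. This leaves `1 ∈ 𝔪`, a contradiction.
    have hzero : β (α (Pi.single a 1)) a = 0 := by
      rw [hβ, Fintype.linearCombination_apply, Finset.sum_apply]
      refine Finset.sum_eq_zero fun b _ => ?_
      have hb := hβ₀ b a
      have := hdP b
      rw [Pi.smul_apply, eq_zero_of_mem_stdGradedPart_neg (by omega) hb, smul_zero]
    rw [hzero, sub_zero] at hmem
    exact one_notMem_span_X hmem
  -- The syzygy module is a retract of `ker φ × F_i` via `(α, id)` and `(β, id - βα)`, as `βα + (id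
  -- - βα) = id`. The free factor has degrees at most `d 0 ≤ d 1`; this is where monotonicity of `d`
  -- enters.
  refine ⟨hdeg, LinearMap.ker φ × (Fin (F.rank i) → MvPolynomial σ K), inferInstance,
    inferInstance, fun j => (subGrading (LinearMap.ker φ) (freeGrading K degP) j).prod
      (freeGrading K (F.deg i) j),
    LinearMap.prod (α.restrict fun p hp => by
      rw [LinearMap.mem_ker] at hp ⊢; rw [hφα, hp, map_zero]) (LinearMap.ker ε).subtype,
    LinearMap.coprod (β.restrict fun p hp => by
      rw [LinearMap.mem_ker] at hp ⊢; rw [hεβ, hp, map_zero])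
      ((LinearMap.id - β ∘ₗ α).codRestrict (LinearMap.ker ε) hβα), ?_, ?_, ?_, ?_⟩
  · intro x
    ext1
    change β (α x.1) + (x.1 - β (α x.1)) = x.1
    exact add_sub_cancel _ _
  · exact fun j m hm => ⟨hαg j _ hm, hm⟩
  · rintro j ⟨k, p⟩ ⟨hk, hp⟩
    exact AddSubgroup.add_mem (freeGrading K (F.deg i) j) (hβg _ _ hk)
      (AddSubgroup.sub_mem _ hp (hβg _ _ (hαg _ _ hp)))
  · refine .horseshoe n ?_ (LinearMap.inl _ _ _) (LinearMap.snd _ _ _) LinearMap.inl_injective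
      ?_ ?_ ?_ ?_ ?_ hK (.free n _ (F.deg i) fun a => (hdeg a).trans (hmono (Nat.zero_le _)))
    · rintro j k p ⟨x, y⟩ hp ⟨hx, hy⟩
      exact ⟨(gradedSMul_free degP).sub _ _ _ _ _ hp hx, gradedSMul_free (F.deg i) _ _ _ _ hp hy⟩
    · intro a
      rfl
    · exact fun j a ha => ⟨ha, zero_mem _⟩
    · exact fun j b hb => hb.2
    · rintro j ⟨x, y⟩ ⟨hx, _⟩ h0
      exact ⟨x, hx, Prod.ext rfl h0.symm⟩
    · exact fun j c hc => ⟨(0, c), ⟨zero_mem _, hc⟩, rfl⟩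

theorem diff_mem_freeGrading (F : MinimalGradedFreeResolution (σ := σ) ℳ) (i : ℕ)
    (b : Fin (F.rank (i + 1))) :
    F.diff i (Pi.single b 1) ∈ freeGrading K (F.deg i) (F.deg (i + 1) b) :=
  fun a => F.diff_mem i b a

/-- The degrees of a minimal resolution of a graded retract `N` of a module with a bounded graded
resolution satisfy the same bounds. The minimal resolution of `N` is a tail of `F`. -/
theorem deg_le_of_retract (F : MinimalGradedFreeResolution (σ := σ) ℳ) (n : ℕ) :
    ∀ {d : ℕ → ℤ} (_ : Monotone d) (i k : ℕ) (_ : k = i + n) {N N' : Type u} [AddCommGroup N]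
    [Module (MvPolynomial σ K) N] [AddCommGroup N'] [Module (MvPolynomial σ K) N']
    {gN : ℤ → AddSubgroup N} {gN' : ℤ → AddSubgroup N'}
    (ε : (Fin (F.rank i) → MvPolynomial σ K) →ₗ[MvPolynomial σ K] N)
    (_ : ∀ j, ∀ p ∈ freeGrading K (F.deg i) j, ε p ∈ gN j)
    (_ : ∀ j, ∀ m ∈ gN j, ∃ p ∈ freeGrading K (F.deg i) j, ε p = m)
    (_ : Function.Exact (F.diff i) ε)
    (r : N →ₗ[MvPolynomial σ K] N') (s : N' →ₗ[MvPolynomial σ K] N) (_ : ∀ x, s (r x) = x)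
    (_ : ∀ j, ∀ m ∈ gN j, r m ∈ gN' j) (_ : ∀ j, ∀ m ∈ gN' j, s m ∈ gN j)
    (_ : ResolutionBound K σ (n + 1) d N' gN') (a : Fin (F.rank k)), F.deg k a ≤ d n := by
  induction n with
  | zero =>
    intro d hmono i k hk N N' _ _ _ _ gN gN' ε hε hεs hex r s hsr hr hs hN'
    obtain rfl : k = i := hk
    exact (F.retract_step 0 hmono k ε hε hεs hex r s hsr hr hs hN').1
  | succ n ih =>
    intro d hmono i k hk N N' _ _ _ _ gN gN' ε hε hεs hex r s hsr hr hs hN'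
    obtain ⟨_, Q, _, _, gQ, r', s', hsr', hr', hs', hQ⟩ :=
      F.retract_step (n + 1) hmono i ε hε hεs hex r s hsr hr hs hN'
    refine ih (d := fun i => d (i + 1)) (fun a b hab => hmono (by omega)) (i + 1) k (by omega)
      ((F.diff i).codRestrict (LinearMap.ker ε) hex.apply_apply_eq_zero)
      (fun j p hp => (gradedSMul_free (F.deg i)).map_mem (F.diff_mem_freeGrading i) hp) ?_ ?_
      r' s' hsr' hr' hs' hQ
    · rintro j ⟨m, hm⟩ hmj
      obtain ⟨x, hx⟩ := (hex _).1 hm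
      have hmj' : m ∈ freeGrading K (F.deg i) j := hmj
      refine ⟨freeComponent (F.deg (i + 1)) j x, freeComponent_mem _ _ _, ?_⟩
      ext1
      change F.diff i (freeComponent (F.deg (i + 1)) j x) = m
      rw [map_freeComponent (F.diff_mem_freeGrading i), hx,
        freeComponent_of_mem hmj']
    · intro y
      rw [← F.exact_succ i y]
      exact ⟨fun h => congrArg Subtype.val h, fun h => Subtype.ext h⟩

end MinimalGradedFreeResolution

theorem gradedSMul_quotientGrading (I : Ideal (MvPolynomial σ K)) :
    GradedSMul (K := K) (σ := σ) fun j => (quotientGrading I j).toAddSubgroup := by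
  rintro i j p _ hp ⟨m, hm, rfl⟩
  exact ⟨p * m, mul_mem_stdGradedPart hp hm, rfl⟩

/-- A homogeneous element of a graded quotient is the image of a homogeneous element under every
surjective homogeneous map from a graded free module. -/
theorem exists_mem_freeGrading_of_surjective {I : Ideal (MvPolynomial σ K)}
    (hI : IsHomogeneousIdeal I) {ι : Type*} [Fintype ι] [DecidableEq ι] {deg : ι → ℤ}
    {φ : (ι → MvPolynomial σ K) →ₗ[MvPolynomial σ K] (MvPolynomial σ K ⧸ I)}
    (hφ : ∀ a, φ (Pi.single a 1) ∈ quotientGrading I (deg a)) (hsurj : Function.Surjective φ)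
    {j : ℤ} {m : MvPolynomial σ K ⧸ I} (hm : m ∈ quotientGrading I j) :
    ∃ p ∈ freeGrading K deg j, φ p = m := by
  obtain ⟨x, hx⟩ := hsurj m
  obtain ⟨s, hs, rfl⟩ := hm
  obtain ⟨T, hT⟩ := exists_sum_freeComponent deg x
  have h := hT (insert j T) (Finset.subset_insert _ _)
  have hmem : ∀ k, φ (freeComponent deg k x) ∈ (quotientGrading I k).toAddSubgroup := fun k =>
    (gradedSMul_quotientGrading I).map_mem (gr := fun j => (quotientGrading I j).toAddSubgroup)
      hφ (freeComponent_mem deg k x)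
  choose t ht ht' using hmem
  refine ⟨freeComponent deg j x, freeComponent_mem deg j x, ?_⟩
  -- A homogeneous lift `s` of `m` agrees modulo `I` with the sum of the lifts `t k`; homogeneity of
  -- `I` then isolates degree `j`.
  have hdiff : s - ∑ k ∈ insert j T, t k ∈ I := by
    rw [← Ideal.Quotient.eq_zero_iff_mem, map_sub, sub_eq_zero, map_sum]
    have h1 := congrArg φ h
    rw [map_sum, hx] at h1
    refine h1.symm.trans (Finset.sum_congr rfl fun k _ => ?_)
    exact (ht' k).symm
  have hj := hI _ hdiff j
  rw [map_sub, map_sum, Finset.sum_eq_single_of_mem j (Finset.mem_insert_self _ _)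
    (fun k _ hk => intComponent_of_mem_ne hk (ht k)), intComponent_of_mem hs,
    intComponent_of_mem (ht j)] at hj
  rw [← ht' j]
  exact (Ideal.Quotient.mk_eq_mk_iff_sub_mem _ _).2 (by
    rw [← neg_sub]
    exact neg_mem hj)

/-- If `I` has a graded resolution with generators of the `i`-th term in degrees at most `d (i + 1)`,
then the graded Betti numbers of the quotient by `I` vanish in degrees larger than `d i`. -/
theorem MinimalGradedFreeResolution.deg_le_of_resolutionBound {I : Ideal (MvPolynomial σ K)}
    (hI : IsHomogeneousIdeal I) {d : ℕ → ℤ} (hmono : Monotone d) (h0 : 0 ≤ d 0)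
    (h : ∀ n, ResolutionBound K σ n (fun i => d (i + 1)) I (subGrading I (polyGrading K σ)))
    (F : MinimalGradedFreeResolution (σ := σ) (quotientGrading I)) (i : ℕ)
    (a : Fin (F.rank i)) : F.deg i a ≤ d i := by
  refine F.deg_le_of_retract i hmono 0 i (by omega)
    (gN := fun j => (quotientGrading I j).toAddSubgroup)
    (gN' := fun j => (quotientGrading I j).toAddSubgroup) F.aug
    (fun j p hp => (gradedSMul_quotientGrading I).map_mem
      (gr := fun j => (quotientGrading I j).toAddSubgroup) F.aug_mem hp)
    (fun j m hm => exists_mem_freeGrading_of_surjective hI F.aug_mem F.aug_surjective hm)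
    F.exact_zero LinearMap.id LinearMap.id (fun _ => rfl) (fun _ _ h => h) (fun _ _ h => h)
    ?_ a
  have hlc : ∀ p : Unit → MvPolynomial σ K, Fintype.linearCombination (MvPolynomial σ K)
      (fun _ : Unit => (1 : MvPolynomial σ K ⧸ I)) p = Ideal.Quotient.mk I (p ()) := by
    intro p
    rw [Fintype.linearCombination_apply, Fintype.sum_unique]
    change Ideal.Quotient.mk I (p () * 1) = _
    rw [mul_one]
  -- The resolution of `R/I` starts with `R` in degree zero, and its first syzygy module is `I`.
  refine ⟨Unit, inferInstance, fun _ => 0, fun _ => 1, fun _ => h0,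
    fun _ => ⟨1, one_mem_stdGradedPart, rfl⟩, ?_, ?_⟩
  · rintro j _ ⟨s, hs, rfl⟩
    refine ⟨fun _ => s, fun _ => by simpa using hs, ?_⟩
    rw [hlc]
    rfl
  · have hker : ∀ p : Unit → MvPolynomial σ K, p ∈ LinearMap.ker (Fintype.linearCombination
        (MvPolynomial σ K) (fun _ : Unit => (1 : MvPolynomial σ K ⧸ I))) ↔ p () ∈ I := by
      intro p
      rw [LinearMap.mem_ker, hlc, Ideal.Quotient.eq_zero_iff_mem]
    let E : I ≃ₗ[MvPolynomial σ K] LinearMap.ker (Fintype.linearCombination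
        (MvPolynomial σ K) (fun _ : Unit => (1 : MvPolynomial σ K ⧸ I))) :=
      { toFun := fun s => ⟨fun _ => s, (hker _).2 s.2⟩
        invFun := fun p => ⟨p.1 (), (hker _).1 p.2⟩
        map_add' := fun _ _ => rfl
        map_smul' := fun _ _ => rfl
        left_inv := fun _ => rfl
        right_inv := fun _ => rfl }
    refine (h i).transfer _ E 0 (fun j m => ?_) (fun i => by simp)
    constructor
    · intro h _
      rw [add_zero, sub_zero]
      exact h
    · intro h
      have := h ()
      rwa [add_zero, sub_zero] at this

end

/-! ### Existence of minimal graded free resolutions -/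

section

variable {K : Type u} [Field K] {σ : Type}

theorem mem_span_X_of_constantCoeff_eq_zero {p : MvPolynomial σ K} (h : constantCoeff p = 0) :
    p ∈ Ideal.span (Set.range (X : σ → MvPolynomial σ K)) := by
  rw [← Set.image_univ, mem_ideal_span_X_image]
  intro m hm
  by_contra! h'
  have : m = 0 := by
    ext i
    exact h' i (Set.mem_univ i)
  subst this
  exact (mem_support_iff.1 hm) h

theorem intComponent_zero_eq (p : MvPolynomial σ K) : intComponent 0 p = C (constantCoeff p) := by
  simp [intComponent, constantCoeff_eq]

/-- A submodule of a graded free module is homogeneous if it contains the components of its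
elements. -/
def IsHomogeneousSubmodule {ι : Type*} (deg : ι → ℤ)
    (N : Submodule (MvPolynomial σ K) (ι → MvPolynomial σ K)) : Prop :=
  ∀ p ∈ N, ∀ j, freeComponent deg j p ∈ N

theorem map_single_mem_freeGrading {ι κ : Type*} [Fintype ι] [DecidableEq ι] {deg : κ → ℤ}
    {dg : ι → ℤ} {v : ι → κ → MvPolynomial σ K} (hv : ∀ a, v a ∈ freeGrading K deg (dg a)) (a : ι) :
    Fintype.linearCombination (MvPolynomial σ K) v (Pi.single a 1) ∈ freeGrading K deg (dg a) := by
  rw [Fintype.linearCombination_apply_single, one_smul]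
  exact hv a

theorem IsHomogeneousSubmodule.ker_linearCombination {ι κ : Type*} [Fintype ι] {deg : κ → ℤ}
    {dg : ι → ℤ} {v : ι → κ → MvPolynomial σ K} (hv : ∀ a, v a ∈ freeGrading K deg (dg a)) :
    IsHomogeneousSubmodule dg (LinearMap.ker (Fintype.linearCombination (MvPolynomial σ K) v)) := by
  classical
  intro p hp j
  rw [LinearMap.mem_ker] at hp ⊢
  rw [map_freeComponent (map_single_mem_freeGrading hv), hp, map_zero]

/-- By noetherianity there are finitely many generators, and their components, which lie in `N`,
generate as well. -/
theorem exists_homogeneous_generators [Finite σ] {ι : Type*} [Fintype ι] {deg : ι → ℤ}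
    {N : Submodule (MvPolynomial σ K) (ι → MvPolynomial σ K)}
    (hN : IsHomogeneousSubmodule deg N) :
    ∃ (k : ℕ) (dg : Fin k → ℤ) (v : Fin k → ι → MvPolynomial σ K),
      (∀ a, v a ∈ freeGrading K deg (dg a)) ∧ Submodule.span _ (Set.range v) = N := by
  classical
  obtain ⟨s, hs⟩ := IsNoetherian.noetherian N
  choose T hT using fun p : ι → MvPolynomial σ K => exists_sum_freeComponent deg p
  let t : Finset (ι → MvPolynomial σ K) :=
    s.biUnion fun p => (T p).image fun j => freeComponent deg j p
  have ht : ∀ q ∈ t, ∃ p ∈ s, ∃ j, freeComponent deg j p = q := by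
    intro q hq
    simp only [t, Finset.mem_biUnion, Finset.mem_image] at hq
    obtain ⟨p, hp, j, _, hj⟩ := hq
    exact ⟨p, hp, j, hj⟩
  choose P hP D hD using ht
  let e := t.equivFin.symm
  refine ⟨t.card, fun a => D (e a) (e a).2, fun a => (e a : ι → MvPolynomial σ K), fun a => ?_,
    le_antisymm ?_ ?_⟩
  · have := freeComponent_mem (K := K) deg (D (e a) (e a).2) (P (e a) (e a).2)
    rwa [hD] at this
  · rw [Submodule.span_le]
    rintro _ ⟨a, rfl⟩
    have := hN (P (e a) (e a).2) (hs ▸ Submodule.subset_span (hP _ _)) (D (e a) (e a).2)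
    rwa [hD] at this
  · rw [← hs, Submodule.span_le]
    intro p hp
    rw [← hT p (T p) subset_rfl]
    refine sum_mem fun j hj => Submodule.subset_span ?_
    have hmem : freeComponent deg j p ∈ t :=
      Finset.mem_biUnion.2 ⟨p, hp, Finset.mem_image.2 ⟨j, hj, rfl⟩⟩
    exact ⟨t.equivFin ⟨_, hmem⟩, by simp [e]⟩

/-- A homogeneous submodule of a graded free module has a homogeneous generating set all of whose
relations have coefficients in the irrelevant ideal. -/
theorem exists_minimal_homogeneous_generators [Finite σ] {ι : Type*} [Fintype ι] {deg : ι → ℤ}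
    {N : Submodule (MvPolynomial σ K) (ι → MvPolynomial σ K)}
    (hN : IsHomogeneousSubmodule deg N) :
    ∃ (k : ℕ) (dg : Fin k → ℤ) (v : Fin k → ι → MvPolynomial σ K),
      (∀ a, v a ∈ freeGrading K deg (dg a)) ∧
      LinearMap.range (Fintype.linearCombination (MvPolynomial σ K) v) = N ∧
      ∀ p ∈ LinearMap.ker (Fintype.linearCombination (MvPolynomial σ K) v), ∀ a,
        p a ∈ Ideal.span (Set.range (X : σ → MvPolynomial σ K)) := by
  classical
  have hex := exists_homogeneous_generators hN
  -- Choose the least possible number of homogeneous generators; a relation with a coefficient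
  -- outside `𝔪` would make one of them redundant.
  obtain ⟨dg, v, hv, hspan⟩ := Nat.find_spec hex
  have hmin := fun m => Nat.find_min hex (m := m)
  generalize Nat.find hex = k at dg v hv hspan hmin
  refine ⟨k, dg, v, hv, by rw [Fintype.range_linearCombination, hspan], fun p hp a => ?_⟩
  by_contra hpa
  have hc : constantCoeff (p a) ≠ 0 := fun h => hpa (mem_span_X_of_constantCoeff_eq_zero h)
  set c := constantCoeff (p a)
  have hq := IsHomogeneousSubmodule.ker_linearCombination hv p hp (dg a)
  set q := freeComponent dg (dg a) p with hqdef
  -- In the component of the relation of degree `dg a`, the coefficient of `v a` is a nonzero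
  -- constant, so `v a` can be eliminated.
  have hqa : q a = C c := by
    rw [hqdef, freeComponent_apply, sub_self, intComponent_zero_eq]
  obtain _ | k := k
  · exact a.elim0
  refine hmin k (Nat.lt_succ_self k) ⟨dg ∘ a.succAbove, v ∘ a.succAbove,
    fun b => hv (a.succAbove b), ?_⟩
  rw [← hspan]
  refine le_antisymm (Submodule.span_mono (Set.range_comp_subset_range _ _)) ?_
  have hsub : ∀ b, v (a.succAbove b) ∈
      Submodule.span (MvPolynomial σ K) (Set.range (v ∘ a.succAbove)) :=
    fun b => Submodule.subset_span ⟨b, rfl⟩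
  rw [Submodule.span_le]
  rintro _ ⟨b, rfl⟩
  rcases Fin.eq_self_or_eq_succAbove a b with rfl | ⟨b, rfl⟩
  · rw [LinearMap.mem_ker, Fintype.linearCombination_apply, Fin.sum_univ_succAbove _ b, hqa] at hq
    have hvb : v b = (C c⁻¹ : MvPolynomial σ K) •
        -∑ i, q (b.succAbove i) • v (b.succAbove i) := by
      rw [← eq_neg_of_add_eq_zero_left hq, smul_smul, ← C_mul, inv_mul_cancel₀ hc, C_1, one_smul]
    rw [hvb]
    exact Submodule.smul_mem _ _ (neg_mem (sum_mem fun i _ => Submodule.smul_mem _ _ (hsub i)))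
  · exact hsub b

/-- A homogeneous submodule of a graded free module of finite rank, contained in the multiple of the
free module by the irrelevant ideal. -/
structure HomogeneousSyzygy (K : Type u) [Field K] (σ : Type) where
  /-- the rank of the free module -/
  rank : ℕ
  /-- the degrees of its basis -/
  deg : Fin rank → ℤ
  /-- the submodule -/
  mod : Submodule (MvPolynomial σ K) (Fin rank → MvPolynomial σ K)
  homogeneous : IsHomogeneousSubmodule deg mod
  minimal : ∀ p ∈ mod, ∀ a, p a ∈ Ideal.span (Set.range (X : σ → MvPolynomial σ K))

namespace HomogeneousSyzygy

variable [Finite σ] (N : HomogeneousSyzygy K σ)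

/-- The degrees of a minimal system of generators. -/
noncomputable def genDeg : Fin (exists_minimal_homogeneous_generators N.homogeneous).choose → ℤ :=
  (exists_minimal_homogeneous_generators N.homogeneous).choose_spec.choose

/-- A minimal system of generators. -/
noncomputable def gen : Fin (exists_minimal_homogeneous_generators N.homogeneous).choose →
    Fin N.rank → MvPolynomial σ K :=
  (exists_minimal_homogeneous_generators N.homogeneous).choose_spec.choose_spec.choose

theorem gen_spec : (∀ a, N.gen a ∈ freeGrading K N.deg (N.genDeg a)) ∧
      LinearMap.range (Fintype.linearCombination (MvPolynomial σ K) N.gen) = N.mod ∧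
      ∀ p ∈ LinearMap.ker (Fintype.linearCombination (MvPolynomial σ K) N.gen), ∀ a,
        p a ∈ Ideal.span (Set.range (X : σ → MvPolynomial σ K)) :=
  (exists_minimal_homogeneous_generators N.homogeneous).choose_spec.choose_spec.choose_spec

/-- The module of relations between the elements of a minimal system of generators. -/
noncomputable def next : HomogeneousSyzygy K σ where
  rank := _
  deg := N.genDeg
  mod := LinearMap.ker (Fintype.linearCombination (MvPolynomial σ K) N.gen)
  homogeneous := .ker_linearCombination N.gen_spec.1
  minimal := N.gen_spec.2.2

end HomogeneousSyzygy

/-- A cyclic graded module defined by a homogeneous ideal contained in the irrelevant ideal has a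
minimal graded free resolution. -/
theorem nonempty_minimalGradedFreeResolution [Finite σ] {I : Ideal (MvPolynomial σ K)}
    (hI : IsHomogeneousIdeal I)
    (hIm : I ≤ Ideal.span (Set.range (X : σ → MvPolynomial σ K))) :
    Nonempty (MinimalGradedFreeResolution (σ := σ) (quotientGrading I)) := by
  -- The iteration starts from `I` inside the free module of rank one; each further term is the
  -- relation module of a minimal generating system.
  let N₀ : HomogeneousSyzygy K σ :=
    { rank := 1
      deg := fun _ => 0
      mod := Submodule.comap (LinearMap.proj 0) I
      homogeneous := by
        intro p hp j
        have hp' : p 0 ∈ I := hp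
        exact hI _ hp' _
      minimal := by
        intro p hp a
        rw [Subsingleton.elim a 0]
        exact hIm hp }
  let N : ℕ → HomogeneousSyzygy K σ := fun i => Nat.rec N₀ (fun _ N => N.next) i
  let δ : (i : ℕ) → (Fin (N (i + 1)).rank → MvPolynomial σ K) →ₗ[MvPolynomial σ K]
      (Fin (N i).rank → MvPolynomial σ K) := fun i =>
    Fintype.linearCombination (MvPolynomial σ K) (N i).gen
  have hrange : ∀ i, LinearMap.range (δ i) = (N i).mod := fun i => (N i).gen_spec.2.1
  have hker : ∀ i, LinearMap.ker (δ i) = (N (i + 1)).mod := fun i => rfl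
  have hδ : ∀ i b, δ i (Pi.single b 1) = (N i).gen b := by
    intro i b
    simp only [δ]
    exact (Fintype.linearCombination_apply_single _ _ _ _).trans (one_smul _ _)
  refine ⟨⟨fun i => (N i).rank, fun i => (N i).deg, δ,
    I.mkQ ∘ₗ LinearMap.proj (φ := fun _ : Fin 1 => MvPolynomial σ K) 0, ?_, ?_, ?_, ?_, ?_, ?_⟩⟩
  · intro i b a
    rw [hδ]
    exact (N i).gen_spec.1 b a
  · intro a
    have ha : a = (0 : Fin 1) := Subsingleton.elim (α := Fin 1) _ _
    subst ha
    exact ⟨1, one_mem_stdGradedPart, rfl⟩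
  · exact (Submodule.mkQ_surjective I).comp fun p => ⟨fun _ => p, rfl⟩
  · rw [LinearMap.exact_iff, hrange, LinearMap.ker_comp, Submodule.ker_mkQ]
    rfl
  · intro i
    exact LinearMap.exact_iff.2 ((hker i).trans (hrange (i + 1)).symm)
  · intro i b a
    exact (N i).minimal _ (hrange i ▸ LinearMap.mem_range_self _ _) a

end

/-! ### Setting variables to zero -/

section Kill

variable {K : Type*} [Field K] {σ : Type*}

open Classical in
/-- The endomorphism of the polynomial ring which sets the variables in `T` to zero. -/
noncomputable def killVars (T : Set σ) : MvPolynomial σ K →ₐ[K] MvPolynomial σ K :=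
  aeval fun s => if s ∈ T then 0 else X s

theorem killVars_X_of_mem {T : Set σ} {s : σ} (h : s ∈ T) : killVars (K := K) T (X s) = 0 := by
  simp [killVars, h]

theorem killVars_X_of_notMem {T : Set σ} {s : σ} (h : s ∉ T) :
    killVars (K := K) T (X s) = X s := by
  simp [killVars, h]

/-- Modulo the variables in `T`, setting them to zero agrees with the identity on every variable,
hence everywhere. -/
theorem sub_killVars_mem (T : Set σ) (p : MvPolynomial σ K) :
    p - killVars T p ∈ Ideal.span (X '' T) := by
  have h : (Ideal.Quotient.mkₐ K (Ideal.span (X '' T))).comp (killVars (K := K) T) =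
      Ideal.Quotient.mkₐ K (Ideal.span (X '' T)) := by
    ext s
    by_cases hs : s ∈ T
    · have hX : (X s : MvPolynomial σ K) ∈ Ideal.span (X '' T) :=
        Ideal.subset_span (Set.mem_image_of_mem _ hs)
      simp [killVars_X_of_mem hs, Ideal.Quotient.eq_zero_iff_mem.2 hX]
    · simp [killVars_X_of_notMem hs]
  rw [← Ideal.Quotient.mk_eq_mk_iff_sub_mem]
  exact (congrArg (fun f => f p) h).symm

theorem killVars_eq_zero_of_mem {T : Set σ} {p : MvPolynomial σ K}
    (hp : p ∈ Ideal.span (X '' T)) : killVars T p = 0 := by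
  have : Ideal.span (X '' T) ≤ RingHom.ker (killVars (K := K) T) := by
    rw [Ideal.span_le]
    rintro _ ⟨s, hs, rfl⟩
    exact killVars_X_of_mem hs
  exact this hp

end Kill

/-! ### Kernels of monomial maps -/

section Toric

variable {K : Type*} [Field K] {σ τ : Type*}

/-- The algebra homomorphism which maps the monomial with exponent `m` to that with exponent
`ψ m`. -/
noncomputable def monomialMap (K : Type*) [Field K] (ψ : (σ →₀ ℕ) →+ (τ →₀ ℕ)) :
    MvPolynomial σ K →ₐ[K] MvPolynomial τ K :=
  aeval fun s => monomial (ψ (Finsupp.single s 1)) 1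

theorem monomialMap_monomial_one (ψ : (σ →₀ ℕ) →+ (τ →₀ ℕ)) (m : σ →₀ ℕ) :
    monomialMap K ψ (monomial m 1) = monomial (ψ m) 1 := by
  induction m using Finsupp.induction_linear with
  | zero => simp
  | add f g hf hg =>
    have : (monomial (f + g) (1 : K)) = monomial f 1 * monomial g 1 := by simp [monomial_mul]
    rw [this, map_mul, hf, hg, map_add, monomial_mul, one_mul]
  | single s k =>
    rw [← X_pow_eq_monomial, map_pow, monomialMap, aeval_X, monomial_pow, one_pow, ← map_nsmul]
    simp

/-- Choosing one preimage of each monomial in the image gives a linear map `θ` back. By hypothesis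
`p` and `θ` of its image agree modulo `J` for monomials, hence for all `p`; on the kernel the second
term vanishes. -/
theorem ker_monomialMap_le (ψ : (σ →₀ ℕ) →+ (τ →₀ ℕ)) (J : Ideal (MvPolynomial σ K))
    (h : ∀ m m', ψ m = ψ m' → monomial m (1 : K) - monomial m' 1 ∈ J) :
    RingHom.ker (monomialMap K ψ) ≤ J := by
  classical
  let inv : (τ →₀ ℕ) → (σ →₀ ℕ) := Function.invFun ψ
  let θ : MvPolynomial τ K →ₗ[K] MvPolynomial σ K :=
    (basisMonomials τ K).constr K fun t => monomial (inv t) 1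
  have hθ : ∀ t, θ (monomial t 1) = monomial (inv t) 1 := by
    intro t
    have := (basisMonomials τ K).constr_basis K (fun t => (monomial (inv t) (1 : K))) t
    simpa [θ] using this
  have key : ∀ p, p - θ (monomialMap K ψ p) ∈ J := by
    intro p
    induction p using MvPolynomial.induction_on' with
    | monomial m c =>
      have hm : (monomial m c : MvPolynomial σ K) = c • monomial m 1 := by
        rw [smul_monomial, smul_eq_mul, mul_one]
      rw [hm, map_smul, map_smul, monomialMap_monomial_one, hθ, ← smul_sub]
      refine Submodule.smul_of_tower_mem J c (h _ _ ?_)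
      exact (Function.invFun_eq ⟨m, rfl⟩).symm
    | add p q hp hq =>
      rw [map_add, map_add, add_sub_add_comm]
      exact add_mem hp hq
  intro p hp
  have := key p
  rwa [RingHom.mem_ker.1 hp, map_zero, sub_zero] at this

end Toric

/-! ### Binomial edge ideals -/

section

variable {K : Type*} [Field K] {n : ℕ}

/-- The `2`-minor `x_i y_j - x_j y_i`. -/
noncomputable def edgeMinor (K : Type*) [Field K] {n : ℕ} (i j : Fin n) : PolyRingXY K n :=
  X (Sum.inl i) * X (Sum.inr j) - X (Sum.inl j) * X (Sum.inr i)

theorem edgeMinor_swap (i j : Fin n) : edgeMinor K i j = -edgeMinor K j i := by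
  unfold edgeMinor
  ring

theorem edgeMinor_mem {G : SimpleGraph (Fin n)} {i j : Fin n} (h : G.Adj i j) :
    edgeMinor K i j ∈ binomialEdgeIdeal K G := by
  rcases lt_or_gt_of_ne h.ne with hij | hij
  · exact Ideal.subset_span ⟨i, j, hij, h, rfl⟩
  · rw [edgeMinor_swap]
    exact neg_mem (Ideal.subset_span ⟨j, i, hij, h.symm, rfl⟩)

theorem binomialEdgeIdeal_le {G : SimpleGraph (Fin n)} {I : Ideal (PolyRingXY K n)}
    (h : ∀ i j, G.Adj i j → edgeMinor K i j ∈ I) : binomialEdgeIdeal K G ≤ I := by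
  refine Ideal.span_le.2 ?_
  rintro _ ⟨i, j, _, hadj, rfl⟩
  exact h i j hadj

theorem binomialEdgeIdeal_mono {G H : SimpleGraph (Fin n)} (h : G ≤ H) :
    binomialEdgeIdeal K G ≤ binomialEdgeIdeal K H :=
  binomialEdgeIdeal_le fun _ _ hadj => edgeMinor_mem (h hadj)

theorem edgeMinor_mem_stdGradedPart (i j : Fin n) :
    edgeMinor K i j ∈ stdGradedPart K (Fin n ⊕ Fin n) 2 :=
  sub_mem (mul_mem_stdGradedPart (X_mem_stdGradedPart _) (X_mem_stdGradedPart _))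
    (mul_mem_stdGradedPart (X_mem_stdGradedPart _) (X_mem_stdGradedPart _))

/-- The variables `x_w, y_w` for `w ∈ A`. -/
def vertexVars (A : Set (Fin n)) : Set (Fin n ⊕ Fin n) := {s | Sum.elim id id s ∈ A}

end

/-! ### Isolating vertices and completing neighbourhoods -/

namespace SimpleGraph

variable {V : Type*} (G : SimpleGraph V)

/-- The graph obtained by removing all edges at the vertices in `A`. -/
def isolate (A : Set V) : SimpleGraph V where
  Adj i j := G.Adj i j ∧ i ∉ A ∧ j ∉ A
  symm := ⟨fun _ _ h => ⟨h.1.symm, h.2.2, h.2.1⟩⟩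
  loopless := ⟨fun _ h => h.1.ne rfl⟩

/-- The graph obtained by joining any two neighbours of `v`. -/
def completeNeighbors (v : V) : SimpleGraph V where
  Adj i j := G.Adj i j ∨ (i ≠ j ∧ G.Adj v i ∧ G.Adj v j)
  symm := ⟨fun _ _ h => h.elim (fun h => .inl h.symm) fun h => .inr ⟨h.1.symm, h.2.2, h.2.1⟩⟩
  loopless := ⟨fun _ h => h.elim (fun h => h.ne rfl) fun h => h.1 rfl⟩

/-- A vertex is simplicial if its neighbours form a clique. -/
def IsSimplicial (v : V) : Prop := ∀ a b, G.Adj v a → G.Adj v b → a ≠ b → G.Adj a b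

variable {G}

theorem isolate_le (A : Set V) : G.isolate A ≤ G := fun _ _ h => h.1

theorem le_completeNeighbors (v : V) : G ≤ G.completeNeighbors v := fun _ _ h => .inl h

theorem completeNeighbors_adj_self {v i : V} : (G.completeNeighbors v).Adj v i ↔ G.Adj v i :=
  ⟨fun h => h.elim id fun h => (h.2.1.ne rfl).elim, .inl⟩

theorem isSimplicial_completeNeighbors_self (v : V) : (G.completeNeighbors v).IsSimplicial v :=
  fun _ _ ha hb hab => .inr
    ⟨hab, completeNeighbors_adj_self.1 ha, completeNeighbors_adj_self.1 hb⟩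

/-- If `u` is a neighbour of `v`, every other neighbour of `u` is already one of `v`; so completing
at `v` never destroys simpliciality. This makes the number of non-simplicial vertices a usable
induction parameter. -/
theorem IsSimplicial.completeNeighbors {u : V} (hu : G.IsSimplicial u) (v : V) :
    (G.completeNeighbors v).IsSimplicial u := by
  intro a b ha hb hab
  by_cases huv : u = v
  · subst huv
    exact isSimplicial_completeNeighbors_self u a b ha hb hab
  by_cases hadj : G.Adj v u
  · have key : ∀ c, (G.completeNeighbors v).Adj u c → c = v ∨ G.Adj v c := by
      rintro c (h | h)
      · by_cases hcv : c = v
        · exact .inl hcv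
        · exact .inr (hu v c hadj.symm h (Ne.symm hcv))
      · exact .inr h.2.2
    rcases key a ha with rfl | ha'
    · rcases key b hb with rfl | hb'
      · exact (hab rfl).elim
      · exact .inl hb'
    · rcases key b hb with rfl | hb'
      · exact .inl ha'.symm
      · exact .inr ⟨hab, ha', hb'⟩
  · have key : ∀ c, (G.completeNeighbors v).Adj u c → G.Adj u c := by
      rintro c (h | h)
      · exact h
      · exact (hadj h.2.1).elim
    exact .inl (hu a b (key a ha) (key b hb) hab)

theorem IsSimplicial.isolate {u : V} (hu : G.IsSimplicial u) (A : Set V) :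
    (G.isolate A).IsSimplicial u :=
  fun a b ha hb hab => ⟨hu a b ha.1 hb.1 hab, ha.2.2, hb.2.2⟩

end SimpleGraph

/-! ### Decomposing the ideal at a vertex -/

section

variable {K : Type*} [Field K] {n : ℕ}

theorem killVars_edgeMinor {T : Set (Fin n ⊕ Fin n)} {i j : Fin n} (h1 : Sum.inl i ∉ T)
    (h2 : Sum.inr i ∉ T) (h3 : Sum.inl j ∉ T) (h4 : Sum.inr j ∉ T) :
    killVars T (edgeMinor K i j) = edgeMinor K i j := by
  simp only [edgeMinor, map_sub, map_mul, killVars_X_of_notMem h1, killVars_X_of_notMem h2,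
    killVars_X_of_notMem h3, killVars_X_of_notMem h4]

theorem killVars_edgeMinor_of_mem {A : Set (Fin n)} {i j : Fin n} (h : i ∈ A ∨ j ∈ A) :
    killVars (vertexVars A) (edgeMinor K i j) = 0 := by
  rcases h with h | h
  · simp [edgeMinor, killVars_X_of_mem (T := vertexVars A) (s := Sum.inl i) h,
      killVars_X_of_mem (T := vertexVars A) (s := Sum.inr i) h]
  · simp [edgeMinor, killVars_X_of_mem (T := vertexVars A) (s := Sum.inl j) h,
      killVars_X_of_mem (T := vertexVars A) (s := Sum.inr j) h]

theorem killVars_edgeMinor_of_notMem {A : Set (Fin n)} {i j : Fin n} (hi : i ∉ A) (hj : j ∉ A) :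
    killVars (vertexVars A) (edgeMinor K i j) = edgeMinor K i j :=
  killVars_edgeMinor hi hi hj hj

theorem killVars_mem_isolate (G : SimpleGraph (Fin n)) (A : Set (Fin n)) {p : PolyRingXY K n}
    (hp : p ∈ binomialEdgeIdeal K G) :
    killVars (vertexVars A) p ∈ binomialEdgeIdeal K (G.isolate A) := by
  have : binomialEdgeIdeal K G ≤
      (binomialEdgeIdeal K (G.isolate A)).comap (killVars (K := K) (vertexVars A)) := by
    refine binomialEdgeIdeal_le fun i j hij => ?_
    rw [Ideal.mem_comap]
    by_cases h : i ∈ A ∨ j ∈ A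
    · rw [killVars_edgeMinor_of_mem h]
      exact zero_mem _
    · push Not at h
      rw [killVars_edgeMinor_of_notMem h.1 h.2]
      exact edgeMinor_mem ⟨hij, h.1, h.2⟩
  exact this hp

/-- For a new edge `ij`, the relation `x_v f_ij = x_i f_vj - x_j f_vi`, and its analogue for `y_v`,
express the product by minors of edges of `G`. -/
theorem mul_mem_of_mem_completeNeighbors {G : SimpleGraph (Fin n)} {v : Fin n}
    {q p : PolyRingXY K n} (hq : q ∈ Ideal.span (X '' vertexVars {v}))
    (hp : p ∈ binomialEdgeIdeal K (G.completeNeighbors v)) : q * p ∈ binomialEdgeIdeal K G := by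
  have hle : Ideal.span (X '' vertexVars {v}) * binomialEdgeIdeal K (G.completeNeighbors v) ≤
      binomialEdgeIdeal K G := by
    rw [binomialEdgeIdeal, Ideal.span_mul_span, Ideal.span_le]
    rintro _ ⟨_, ⟨s, hs, rfl⟩, _, ⟨i, j, _, hij, rfl⟩, rfl⟩
    change X s * edgeMinor K i j ∈ binomialEdgeIdeal K G
    rcases hij with hij | ⟨_, hi, hj⟩
    · exact Ideal.mul_mem_left _ _ (edgeMinor_mem hij)
    · have h1 := edgeMinor_mem (K := K) hi
      have h2 := edgeMinor_mem (K := K) hj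
      rcases s with w | w
      · obtain rfl : w = v := hs
        have : X (Sum.inl w) * edgeMinor K i j =
            X (Sum.inl i) * edgeMinor K w j - X (Sum.inl j) * edgeMinor K w i := by
          unfold edgeMinor
          ring
        rw [this]
        exact sub_mem (Ideal.mul_mem_left _ _ h2) (Ideal.mul_mem_left _ _ h1)
      · obtain rfl : w = v := hs
        have : X (Sum.inr w) * edgeMinor K i j =
            X (Sum.inr i) * edgeMinor K w j - X (Sum.inr j) * edgeMinor K w i := by
          unfold edgeMinor
          ring
        rw [this]
        exact sub_mem (Ideal.mul_mem_left _ _ h2) (Ideal.mul_mem_left _ _ h1)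
  exact hle (Ideal.mul_mem_mul hq hp)

/-- Edges at `v` are old, and minors of edges away from `v` are fixed by the substitution, so the
claim holds for generators. A product rule extends it to multiples, its error term being absorbed by
`mul_mem_of_mem_completeNeighbors`. -/
theorem sub_killVars_mem_of_mem_completeNeighbors {G : SimpleGraph (Fin n)} {v : Fin n}
    {p : PolyRingXY K n} (hp : p ∈ binomialEdgeIdeal K (G.completeNeighbors v)) :
    p - killVars (vertexVars {v}) p ∈ binomialEdgeIdeal K G := by
  induction hp using Submodule.span_induction with
  | mem x hx =>
    obtain ⟨i, j, _, hij, rfl⟩ := hx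
    change edgeMinor K i j - killVars (vertexVars {v}) (edgeMinor K i j) ∈ _
    by_cases h : i ∈ ({v} : Set (Fin n)) ∨ j ∈ ({v} : Set (Fin n))
    · rw [killVars_edgeMinor_of_mem h, sub_zero]
      rcases hij with hij | ⟨_, hi, hj⟩
      · exact edgeMinor_mem hij
      · rcases h with h | h
        · exact (hi.ne h.symm).elim
        · exact (hj.ne h.symm).elim
    · push Not at h
      rw [killVars_edgeMinor_of_notMem h.1 h.2, sub_self]
      exact zero_mem _
  | zero => simp
  | add x y _ _ hx hy =>
    rw [map_add, add_sub_add_comm]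
    exact add_mem hx hy
  | smul q p hp ih =>
    have : q • p - killVars (vertexVars {v}) (q • p) =
        q * (p - killVars (vertexVars {v}) p) +
          (q - killVars (vertexVars {v}) q) * killVars (vertexVars {v}) p := by
      rw [smul_eq_mul, map_mul]
      ring
    rw [this]
    refine add_mem (Ideal.mul_mem_left _ _ ih)
      (mul_mem_of_mem_completeNeighbors (sub_killVars_mem _ _) ?_)
    exact binomialEdgeIdeal_mono (SimpleGraph.isolate_le _) (killVars_mem_isolate _ _ hp)

/-- The ideal `J_G` is the intersection of `J_{G_v}`, where `G_v` arises by completing the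
neighbourhood of `v`, and `(x_v, y_v) + J_{G - v}`. -/
theorem mem_binomialEdgeIdeal_of_mem_of_killVars_mem {G : SimpleGraph (Fin n)} (v : Fin n)
    {p : PolyRingXY K n} (hp : p ∈ binomialEdgeIdeal K (G.completeNeighbors v))
    (hk : killVars (vertexVars {v}) p ∈ binomialEdgeIdeal K (G.isolate {v})) :
    p ∈ binomialEdgeIdeal K G := by
  rw [← sub_add_cancel p (killVars (vertexVars {v}) p)]
  exact add_mem (sub_killVars_mem_of_mem_completeNeighbors hp)
    (binomialEdgeIdeal_mono (SimpleGraph.isolate_le _) hk)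

end

/-! ### Unions of cliques, regular elements and the colon ideal -/

section

variable {K : Type*} [Field K] {n : ℕ}

namespace SimpleGraph

variable {V : Type*} {G : SimpleGraph V}

/-- The connected components of a graph in which every vertex is simplicial. -/
def cliqueSetoid (hG : ∀ v, G.IsSimplicial v) : Setoid V where
  r a b := a = b ∨ G.Adj a b
  iseqv :=
    { refl := fun _ => .inl rfl
      symm := fun h => h.elim (fun h => .inl h.symm) fun h => .inr h.symm
      trans := by
        rintro a b c (rfl | hab) (rfl | hbc)
        · exact .inl rfl
        · exact .inr hbc
        · exact .inr hab
        · by_cases hac : a = c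
          · exact .inl hac
          · exact .inr (hG b a c hab.symm hbc hac) }

end SimpleGraph

variable {Q : Type*} (q : Fin n → Q)

/-- The exponent map of `x_i ↦ a_i s_c`, `y_i ↦ a_i`, where `c` is the class of `i`. -/
noncomputable def cliqueExponent : (Fin n ⊕ Fin n →₀ ℕ) →+ (Fin n ⊕ Q →₀ ℕ) :=
  Finsupp.liftAddHom fun s => multiplesHom _ (Sum.elim
    (fun i => Finsupp.single (Sum.inl i) 1 + Finsupp.single (Sum.inr (q i)) 1)
    (fun i => Finsupp.single (Sum.inl i) 1) s)

theorem cliqueExponent_single (s : Fin n ⊕ Fin n) (k : ℕ) :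
    cliqueExponent q (Finsupp.single s k) = k • Sum.elim
    (fun i => Finsupp.single (Sum.inl i) 1 + Finsupp.single (Sum.inr (q i)) 1)
    (fun i => Finsupp.single (Sum.inl i) 1) s := by
  simp [cliqueExponent]

theorem cliqueExponent_inl (m : Fin n ⊕ Fin n →₀ ℕ) (i : Fin n) :
    cliqueExponent q m (Sum.inl i) = m (Sum.inl i) + m (Sum.inr i) := by
  classical
  induction m using Finsupp.induction_linear with
  | zero => simp
  | add f g hf hg =>
    rw [map_add, Finsupp.add_apply, hf, hg, Finsupp.add_apply, Finsupp.add_apply]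
    ring
  | single s k =>
    rw [cliqueExponent_single]
    rcases s with j | j <;> simp [Finsupp.single_apply]

theorem cliqueExponent_inr [DecidableEq Q] (m : Fin n ⊕ Fin n →₀ ℕ) (c : Q) :
    cliqueExponent q m (Sum.inr c) = ∑ i with q i = c, m (Sum.inl i) := by
  classical
  induction m using Finsupp.induction_linear with
  | zero => simp
  | add f g hf hg =>
    rw [map_add, Finsupp.add_apply, hf, hg, ← Finset.sum_add_distrib]
    rfl
  | single s k =>
    rw [cliqueExponent_single]
    rcases s with j | j
    · by_cases h : q j = c
      · rw [Finset.sum_eq_single_of_mem j (by simpa using h)]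
        · simp [h]
        · intro b _ hb
          simp [hb.symm]
      · rw [Finset.sum_eq_zero]
        · simp [h]
        · intro b hb
          have : j ≠ b := by
            rintro rfl
            simp [h] at hb
          simp [this]
    · simp

/-- Monomials with the same image under the parametrization of a union of cliques are congruent
modulo the binomial edge ideal. -/
theorem monomial_sub_monomial_mem {J : Ideal (PolyRingXY K n)}
    (hJ : ∀ i j, q i = q j → edgeMinor K i j ∈ J) (N : ℕ) :
    ∀ m m' : Fin n ⊕ Fin n →₀ ℕ, ∑ i, (m (Sum.inl i) - m' (Sum.inl i)) = N →
    cliqueExponent q m = cliqueExponent q m' → monomial m (1 : K) - monomial m' 1 ∈ J := by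
  classical
  induction N using Nat.strong_induction_on with
  | _ N ih =>
  intro m m' hN hmm
  have hrow : ∀ i, m (Sum.inl i) + m (Sum.inr i) = m' (Sum.inl i) + m' (Sum.inr i) := by
    intro i
    rw [← cliqueExponent_inl q, ← cliqueExponent_inl q, hmm]
  have hcol : ∀ c, ∑ i with q i = c, m (Sum.inl i) = ∑ i with q i = c, m' (Sum.inl i) := by
    intro c
    rw [← cliqueExponent_inr q, ← cliqueExponent_inr q, hmm]
  by_cases hle : ∀ i, m (Sum.inl i) ≤ m' (Sum.inl i)
  · have heq : ∀ i, m (Sum.inl i) = m' (Sum.inl i) := by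
      intro i
      exact (Finset.sum_eq_sum_iff_of_le (fun j _ => hle j)).1 (hcol (q i)) i (by simp)
    have : m = m' := by
      ext s
      rcases s with i | i
      · exact heq i
      · have := hrow i
        have := heq i
        omega
    rw [this, sub_self]
    exact zero_mem _
  · push Not at hle
    obtain ⟨i, hi⟩ := hle
    -- The `x`-degrees of `m` and `m'` agree on each clique, so an excess at `i` is balanced by a
    -- deficit at some `j` in its clique. Trading `x_i y_j` for `x_j y_i` lowers the total excess,
    -- the sum of truncated differences.
    obtain ⟨j, hj, hjlt⟩ : ∃ j, q j = q i ∧ m (Sum.inl j) < m' (Sum.inl j) := by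
      by_contra! h
      have := Finset.sum_lt_sum (s := Finset.univ.filter fun k => q k = q i)
        (f := fun k => m' (Sum.inl k)) (g := fun k => m (Sum.inl k))
        (fun k hk => h k (by simpa using hk)) ⟨i, by simp, hi⟩
      exact absurd (hcol (q i)) this.ne'
    have hij : i ≠ j := by
      rintro rfl
      omega
    set e : Fin n ⊕ Fin n →₀ ℕ := Finsupp.single (Sum.inl i) 1 + Finsupp.single (Sum.inr j) 1
      with he
    set e' : Fin n ⊕ Fin n →₀ ℕ := Finsupp.single (Sum.inl j) 1 + Finsupp.single (Sum.inr i) 1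
      with he'
    -- The exponent of `y_j` in `m` is positive because at `j` the `x`-exponent is smaller than in
    -- `m'` while the total is the same.
    have hem : e ≤ m := by
      intro s
      have := hrow j
      rcases s with k | k
      · by_cases hk : i = k
        · subst hk
          simp [he]
          omega
        · simp [he, hk]
      · by_cases hk : j = k
        · subst hk
          simp [he]
          omega
        · simp [he, hk]
    obtain ⟨m₀, rfl⟩ := exists_add_of_le hem
    have hψ : cliqueExponent q e = cliqueExponent q e' := by
      rw [he, he', map_add, map_add]
      simp only [cliqueExponent_single, Sum.elim_inl, Sum.elim_inr, one_smul, hj]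
      abel
    have hstep : monomial (e + m₀) (1 : K) - monomial (e' + m₀) 1 ∈ J := by
      have : monomial (e + m₀) (1 : K) - monomial (e' + m₀) 1 =
          edgeMinor K i j * monomial m₀ 1 := by
        rw [edgeMinor, sub_mul]
        simp only [X, monomial_mul, one_mul, he, he']
      rw [this]
      exact Ideal.mul_mem_right _ _ (hJ i j hj.symm)
    have hval : ∀ k, (e' + m₀) (Sum.inl k) + (if i = k then 1 else 0) =
        (e + m₀) (Sum.inl k) + (if j = k then 1 else 0) := by
      intro k
      simp [he, he', Finsupp.single_apply]
      omega
    have hlt : ∑ k, ((e' + m₀) (Sum.inl k) - m' (Sum.inl k)) < N := by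
      rw [← hN]
      refine Finset.sum_lt_sum (fun k _ => ?_) ⟨i, Finset.mem_univ _, ?_⟩
      · have := hval k
        by_cases hjk : j = k
        · subst hjk
          rw [if_neg hij, if_pos rfl] at this
          omega
        · rw [if_neg hjk] at this
          omega
      · have := hval i
        rw [if_pos rfl, if_neg hij.symm] at this
        omega
    have := ih _ hlt (e' + m₀) m' rfl (by
      rw [← hmm, map_add _ e', map_add _ e, hψ])
    rw [← sub_add_sub_cancel]
    exact add_mem hstep this

/-- The binomial edge ideal of a disjoint union of cliques is prime. -/
theorem binomialEdgeIdeal_isPrime_of_isSimplicial {G : SimpleGraph (Fin n)}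
    (hG : ∀ v, G.IsSimplicial v) : (binomialEdgeIdeal K G).IsPrime := by
  classical
  let q : Fin n → Quotient (SimpleGraph.cliqueSetoid hG) := Quotient.mk _
  have hadj : ∀ i j, q i = q j ↔ i = j ∨ G.Adj i j := fun i j => Quotient.eq
  -- The ideal is the kernel of the parametrization `x_i ↦ a_i s_c`, `y_i ↦ a_i` into a domain.
  have hker : binomialEdgeIdeal K G = RingHom.ker (monomialMap K (cliqueExponent q)) := by
    refine le_antisymm (binomialEdgeIdeal_le fun i j hij => ?_) (ker_monomialMap_le _ _ fun m m' h =>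
      monomial_sub_monomial_mem q (fun i j hij => ?_) _ m m' rfl h)
    · have hq : q i = q j := (hadj i j).2 (.inr hij)
      have hψ : cliqueExponent q (Finsupp.single (Sum.inl i) 1 + Finsupp.single (Sum.inr j) 1) =
          cliqueExponent q (Finsupp.single (Sum.inl j) 1 + Finsupp.single (Sum.inr i) 1) := by
        simp only [map_add, cliqueExponent_single, Sum.elim_inl, Sum.elim_inr, one_smul, hq]
        abel
      rw [RingHom.mem_ker, edgeMinor]
      simp only [X, monomial_mul, one_mul]
      rw [map_sub, monomialMap_monomial_one, monomialMap_monomial_one, hψ, sub_self]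
    · rcases (hadj i j).1 hij with rfl | h
      · have : edgeMinor K i i = 0 := sub_self _
        rw [this]
        exact zero_mem _
      · exact edgeMinor_mem h
  rw [hker]
  exact RingHom.ker_isPrime _

/-- If `v` is simplicial and `u` is isolated, then polynomials in the variables of `u` and `v` which
lie in no binomial edge ideal of a graph with `u` isolated are regular modulo `J_G`. -/
theorem mem_binomialEdgeIdeal_of_mul_mem {u v : Fin n} {z : PolyRingXY K n}
    (hz : ∀ w, w ≠ u → w ≠ v → killVars (vertexVars {w}) z = z)
    (hz' : ∀ G : SimpleGraph (Fin n), (∀ a, ¬G.Adj u a) → z ∉ binomialEdgeIdeal K G) (N : ℕ) :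
    ∀ G : SimpleGraph (Fin n), {w | ¬G.IsSimplicial w}.ncard = N → (∀ a, ¬G.Adj u a) →
      G.IsSimplicial v → ∀ g, g * z ∈ binomialEdgeIdeal K G → g ∈ binomialEdgeIdeal K G := by
  induction N using Nat.strong_induction_on with
  | _ N ih =>
  intro G hN hu hv g hg
  by_cases hall : ∀ w, G.IsSimplicial w
  · exact ((binomialEdgeIdeal_isPrime_of_isSimplicial hall).mem_or_mem hg).resolve_right (hz' G hu)
  · push Not at hall
    obtain ⟨w, hw⟩ := hall
    have hwu : w ≠ u := by
      rintro rfl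
      exact hw fun a b ha => (hu a ha).elim
    have hwv : w ≠ v := by
      rintro rfl
      exact hw hv
    have hcard : ∀ H : SimpleGraph (Fin n), (∀ a, G.IsSimplicial a → H.IsSimplicial a) →
        H.IsSimplicial w → {a | ¬H.IsSimplicial a}.ncard < N := by
      intro H h1 h2
      rw [← hN]
      refine Set.ncard_lt_ncard ⟨fun a ha h => ha (h1 a h), fun h => h hw h2⟩ (Set.toFinite _)
    have hws : (G.isolate {w}).IsSimplicial w := fun a b ha => (ha.2.1 rfl).elim
    -- Both parts of the decomposition at `w` have fewer non-simplicial vertices, and `z` survives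
    -- setting the variables of `w` to zero.
    refine mem_binomialEdgeIdeal_of_mem_of_killVars_mem w ?_ ?_
    · refine ih _ (hcard (G.completeNeighbors w) (fun a ha => ha.completeNeighbors w)
        (SimpleGraph.isSimplicial_completeNeighbors_self w)) _ rfl ?_ (hv.completeNeighbors w) g
        (binomialEdgeIdeal_mono (SimpleGraph.le_completeNeighbors w) hg)
      rintro a (ha | ha)
      · exact hu a ha
      · exact hu w ha.2.1.symm
    · refine ih _ (hcard (G.isolate {w}) (fun a ha => ha.isolate _) hws) _ rfl
        (fun a ha => hu a ha.1) (hv.isolate _) _ ?_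
      have := killVars_mem_isolate G {w} hg
      rwa [map_mul, hz w hwu hwv] at this

/-- A variable of an isolated vertex is regular modulo a binomial edge ideal. -/
theorem mem_binomialEdgeIdeal_of_mul_X_mem {G : SimpleGraph (Fin n)} {s : Fin n ⊕ Fin n}
    (hs : ∀ a, ¬G.Adj (Sum.elim id id s) a) {g : PolyRingXY K n}
    (hg : g * X s ∈ binomialEdgeIdeal K G) : g ∈ binomialEdgeIdeal K G := by
  classical
  refine mem_binomialEdgeIdeal_of_mul_mem (u := Sum.elim id id s) (v := Sum.elim id id s)
    (z := X s) (fun w hw _ => killVars_X_of_notMem fun h => hw h.symm) (fun H _ h => ?_) _ G rfl hs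
    (fun a b ha => (hs a ha).elim) g hg
  -- At the point whose only nonzero coordinate is that of `s`, all minors vanish but `X s` does
  -- not.
  have hle : binomialEdgeIdeal K H ≤
      RingHom.ker (eval fun t : Fin n ⊕ Fin n => if t = s then (1 : K) else 0) := by
    refine binomialEdgeIdeal_le fun i j _ => ?_
    rw [RingHom.mem_ker]
    rcases s with k | k <;> simp [edgeMinor]
  have := hle h
  simp at this

/-- The minor of an isolated and a simplicial vertex is regular modulo a binomial edge ideal. -/
theorem mem_binomialEdgeIdeal_of_mul_edgeMinor_mem {G : SimpleGraph (Fin n)} {u v : Fin n}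
    (huv : u ≠ v) (hu : ∀ a, ¬G.Adj u a) (hv : G.IsSimplicial v) {g : PolyRingXY K n}
    (hg : g * edgeMinor K u v ∈ binomialEdgeIdeal K G) : g ∈ binomialEdgeIdeal K G := by
  classical
  refine mem_binomialEdgeIdeal_of_mul_mem (u := u) (v := v) (z := edgeMinor K u v)
    (fun w hwu hwv => killVars_edgeMinor_of_notMem (fun h => hwu h.symm) fun h => hwv h.symm)
    (fun H hH h => ?_) _ G rfl hu hv g hg
  -- At the point with only `x_u = y_v = 1`, minors avoiding `u` vanish, while the minor of `u` and
  -- `v` takes the value `1`.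
  have hle : binomialEdgeIdeal K H ≤ RingHom.ker (eval (Sum.elim
      (fun t => if t = u then (1 : K) else 0) (fun t => if t = v then (1 : K) else 0))) := by
    refine binomialEdgeIdeal_le fun i j hij => ?_
    have hi : i ≠ u := by
      rintro rfl
      exact hH j hij
    have hj : j ≠ u := by
      rintro rfl
      exact hH i hij.symm
    simp [RingHom.mem_ker, edgeMinor, hi, hj]
  have := hle h
  simp [RingHom.mem_ker, edgeMinor, huv.symm] at this

/-- The colon ideal of a binomial edge ideal by the minor of a removed edge `uv` at a simplicial
vertex `u`. -/
theorem mem_colon_deleteEdges_iff {G : SimpleGraph (Fin n)} {u v : Fin n} (hu : G.IsSimplicial u)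
    (huv : G.Adj u v) (g : PolyRingXY K n) :
    g ∈ binomialEdgeIdeal K ((G.isolate {w | w = u ∨ (G.Adj u w ∧ w ≠ v)}).completeNeighbors v) ⊔
      Ideal.span (X '' vertexVars {w | G.Adj u w ∧ w ≠ v}) ↔
    g * edgeMinor K u v ∈ binomialEdgeIdeal K (G.deleteEdges {s(u, v)}) := by
  set A : Set (Fin n) := {w | w = u ∨ (G.Adj u w ∧ w ≠ v)} with hA
  set W : Set (Fin n) := {w | G.Adj u w ∧ w ≠ v} with hW
  set J := binomialEdgeIdeal K (G.deleteEdges {s(u, v)}) with hJ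
  have hmem : ∀ i j, G.Adj i j → (i ≠ u ∨ j ≠ v) → (i ≠ v ∨ j ≠ u) → edgeMinor K i j ∈ J := by
    intro i j hij h1 h2
    refine edgeMinor_mem (SimpleGraph.deleteEdges_adj.2 ⟨hij, ?_⟩)
    simp only [Set.mem_singleton_iff, Sym2.eq_iff]
    tauto
  constructor
  · let L : Ideal (PolyRingXY K n) :=
      Submodule.comap (LinearMap.toSpanSingleton (PolyRingXY K n) _ (edgeMinor K u v)) J
    have hL : ∀ p, p ∈ L ↔ p * edgeMinor K u v ∈ J := fun p => Iff.rfl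
    intro hg
    rw [← hL]
    refine sup_le (binomialEdgeIdeal_le fun i j hij => ?_) (Ideal.span_le.2 ?_) hg
    · rw [hL]
      rcases hij with hij | ⟨_, hi, hj⟩
      · have hi : i ≠ u := fun h => hij.2.1 (.inl h)
        have hj : j ≠ u := fun h => hij.2.2 (.inl h)
        exact Ideal.mul_mem_right _ _ (hmem i j hij.1 (.inl hi) (.inr hj))
      · have hiu : i ≠ u := fun h => hi.2.2 (.inl h)
        have hju : j ≠ u := fun h => hj.2.2 (.inl h)
        have hvu : v ≠ u := huv.ne.symm
        -- A Plücker relation; both `vi` and `vj` are edges that survive the deletion.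
        have : edgeMinor K i j * edgeMinor K u v =
            edgeMinor K v i * edgeMinor K j u - edgeMinor K v j * edgeMinor K i u := by
          unfold edgeMinor
          ring
        rw [this]
        exact sub_mem (Ideal.mul_mem_right _ _ (hmem v i hi.1 (.inl hvu) (.inr hiu)))
          (Ideal.mul_mem_right _ _ (hmem v j hj.1 (.inl hvu) (.inr hju)))
    · rintro _ ⟨s, hs, rfl⟩
      change X s ∈ L
      rw [hL]
      -- Simpliciality of `u` makes `w` a common neighbour of `u` and `v`, so the relation `x_w f_uv
      -- = x_u f_wv - x_v f_wu` stays inside `J`.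
      have key : ∀ w, G.Adj u w → w ≠ v → edgeMinor K w v ∈ J ∧ edgeMinor K w u ∈ J := by
        intro w hw hwv
        exact ⟨hmem w v (hu w v hw huv hwv) (.inl hw.ne.symm) (.inl hwv),
          hmem w u hw.symm (.inl hw.ne.symm) (.inl hwv)⟩
      rcases s with w | w
      · obtain ⟨h1, h2⟩ := key w hs.1 hs.2
        have : X (Sum.inl w) * edgeMinor K u v =
            X (Sum.inl u) * edgeMinor K w v - X (Sum.inl v) * edgeMinor K w u := by
          unfold edgeMinor
          ring
        rw [this]
        exact sub_mem (Ideal.mul_mem_left _ _ h1) (Ideal.mul_mem_left _ _ h2)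
      · obtain ⟨h1, h2⟩ := key w hs.1 hs.2
        have : X (Sum.inr w) * edgeMinor K u v =
            X (Sum.inr u) * edgeMinor K w v - X (Sum.inr v) * edgeMinor K w u := by
          unfold edgeMinor
          ring
        rw [this]
        exact sub_mem (Ideal.mul_mem_left _ _ h1) (Ideal.mul_mem_left _ _ h2)
  · intro hg
    -- Setting the variables of `W` to zero removes all edges at `u` except the deleted one. After
    -- completing at `v` the minor of `uv` is regular, so it can be cancelled.
    have huW : u ∉ W := fun h => h.1.ne rfl
    have hvW : v ∉ W := fun h => h.2 rfl
    have hk := killVars_mem_isolate _ W hg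
    rw [map_mul, killVars_edgeMinor_of_notMem huW hvW] at hk
    have hle : (G.deleteEdges {s(u, v)}).isolate W ≤ (G.isolate A).completeNeighbors v := by
      intro i j hij
      have hne : ∀ a b, ((G.deleteEdges {s(u, v)}).isolate W).Adj a b → a ≠ u := by
        rintro a b hab rfl
        have h := SimpleGraph.deleteEdges_adj.1 hab.1
        have hbv : b ≠ v := by
          rintro rfl
          exact h.2 rfl
        exact hab.2.2 ⟨h.1, hbv⟩
      refine .inl ⟨(SimpleGraph.deleteEdges_adj.1 hij.1).1, ?_, ?_⟩
      · rintro (h | h)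
        · exact hne i j hij h
        · exact hij.2.1 h
      · rintro (h | h)
        · exact hne j i hij.symm h
        · exact hij.2.2 h
    have hk' := mem_binomialEdgeIdeal_of_mul_edgeMinor_mem huv.ne (by
      rintro a (ha | ha)
      · exact ha.2.1 (.inl rfl)
      · exact ha.2.1.2.2 (.inl rfl))
      (SimpleGraph.isSimplicial_completeNeighbors_self v) (binomialEdgeIdeal_mono hle hk)
    rw [← sub_add_cancel g (killVars (vertexVars W) g)]
    exact add_mem (Ideal.mem_sup_right (sub_killVars_mem _ _)) (Ideal.mem_sup_left hk')

end

/-! ### Chordality as a condition on paths -/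

namespace SimpleGraph

variable {V : Type*} {G : SimpleGraph V}

/-- An edge between vertices that are not consecutive would give a shortcut. -/
theorem Walk.mk_getVert_mem_edges_of_length_eq_dist {a b : V} {w : G.Walk a b}
    (hw : w.length = G.dist a b) {i j : ℕ} (hij : i < j) (hj : j ≤ w.length)
    (h : G.Adj (w.getVert i) (w.getVert j)) : s(w.getVert i, w.getVert j) ∈ w.edges := by
  have hle := G.dist_le ((w.take i).append (Walk.cons h (w.drop j)))
  rw [Walk.length_append, Walk.length_cons, Walk.take_length, Walk.drop_length] at hle
  obtain rfl : j = i + 1 := by omega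
  exact (Walk.mk_mem_edges_iff_exists _).2 ⟨i, by omega, rfl⟩

/-- A walk of minimal length has no chords. -/
theorem Walk.mk_mem_edges_of_length_eq_dist {a b u v : V} {w : G.Walk a b}
    (hw : w.length = G.dist a b) (hu : u ∈ w.support) (hv : v ∈ w.support) (h : G.Adj u v) :
    s(u, v) ∈ w.edges := by
  obtain ⟨i, rfl, hi⟩ := Walk.mem_support_iff_exists_getVert.1 hu
  obtain ⟨j, rfl, hj⟩ := Walk.mem_support_iff_exists_getVert.1 hv
  rcases lt_trichotomy i j with hij | rfl | hij
  · exact mk_getVert_mem_edges_of_length_eq_dist hw hij hj h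
  · exact (h.ne rfl).elim
  · rw [Sym2.eq_swap]
    exact mk_getVert_mem_edges_of_length_eq_dist hw hij hi h.symm

/-- Adjacency with the second vertex outside the closed neighbourhood of `p`. -/
def AvoidAdj (G : SimpleGraph V) (p s t : V) : Prop := G.Adj s t ∧ t ≠ p ∧ ¬G.Adj p t

/-- Two neighbours of a vertex `p` which are joined by a path outside the closed neighbourhood of
`p` are adjacent. This is equivalent to chordality. -/
def IsPathChordal (G : SimpleGraph V) : Prop :=
  ∀ p a b x y, G.Adj p a → G.Adj p b → a ≠ b → G.Adj a x → G.Adj b y → x ≠ p → ¬G.Adj p x →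
    Relation.ReflTransGen (G.AvoidAdj p) x y → G.Adj a b

/-- Suppose `a` and `b` are not adjacent. Take a shortest path between them in the subgraph induced
on `a`, `b` and the vertices outside the closed neighbourhood of `p`. Closing it through `p` gives a
cycle without chords: the path has none, and `p` sees only `a` and `b`. -/
theorem IsChordalGraph.isPathChordal (hG : G.IsChordalGraph) : G.IsPathChordal := by
  classical
  intro p a b x y hpa hpb hab hax hby hxp hpx hxy
  by_contra hnab
  let S : Set V := {t | (t ≠ p ∧ ¬G.Adj p t) ∨ t = a ∨ t = b}
  let H : SimpleGraph V :=
    { Adj := fun s t => G.Adj s t ∧ s ∈ S ∧ t ∈ S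
      symm := ⟨fun _ _ h => ⟨h.1.symm, h.2.2, h.2.1⟩⟩
      loopless := ⟨fun _ h => h.1.ne rfl⟩ }
  have hHG : H ≤ G := fun _ _ h => h.1
  have haS : a ∈ S := .inr (.inl rfl)
  have hbS : b ∈ S := .inr (.inr rfl)
  have hpS : p ∉ S := by
    rintro (h | h | h)
    · exact h.1 rfl
    · exact hpa.ne h
    · exact hpb.ne h
  have hreach : ∀ z, Relation.ReflTransGen (G.AvoidAdj p) x z →
      H.Reachable a z ∧ z ≠ p ∧ ¬G.Adj p z := by
    intro z hz
    induction hz with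
    | refl => exact ⟨Adj.reachable ⟨hax, haS, .inl ⟨hxp, hpx⟩⟩, hxp, hpx⟩
    | tail _ hst ih =>
      exact ⟨ih.1.trans (Adj.reachable ⟨hst.1, .inl ih.2, .inl hst.2⟩), hst.2⟩
  obtain ⟨hay, hy⟩ := hreach y hxy
  have hyb : H.Adj y b := ⟨hby.symm, .inl hy, hbS⟩
  obtain ⟨w, hw⟩ := (hay.trans hyb.reachable).exists_walk_length_eq_dist
  have hpath := w.isPath_of_length_eq_dist hw
  have hsupp : ∀ t ∈ w.support, t ∈ S := by
    intro t ht
    by_cases hta : t = a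
    · exact hta ▸ haS
    · obtain ⟨i, rfl, hi⟩ := Walk.mem_support_iff_exists_getVert.1 ht
      obtain _ | i := i
      · exact (hta (by simp)).elim
      · exact (w.adj_getVert_succ (i := i) (by omega)).2.2
  -- Together with the two edges at `p` the cycle then has length at least four.
  have hlen : 2 ≤ w.length := by
    by_contra! hlt
    interval_cases h : w.length
    · exact hab (Walk.eq_of_length_eq_zero h)
    · exact hnab (Walk.adj_of_length_eq_one h).1
  have hpw : p ∉ w.support := fun h => hpS (hsupp p h)
  let w' : G.Walk a b := w.mapLe hHG
  have hsw : w'.support = w.support := Walk.support_mapLe_eq_support _ _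
  have hew : w'.edges = w.edges := Walk.edges_mapLe_eq_edges _ _
  let c : G.Walk p p := Walk.cons hpa (w'.concat hpb.symm)
  have hedges : ∀ e, e ∈ c.edges ↔ e = s(p, a) ∨ e ∈ w.edges ∨ e = s(b, p) := by
    intro e
    simp [c, Walk.edges_concat, hew]
  have hcycle : c.IsCycle := by
    refine (Walk.cons_isCycle_iff _ _).2
      ⟨Walk.IsPath.concat (Walk.IsPath.mapLe hHG hpath) (by rwa [hsw]) _, ?_⟩
    rw [Walk.edges_concat, List.concat_eq_append, List.mem_append, List.mem_singleton]
    rintro (h | h)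
    · exact hpw (hsw ▸ Walk.fst_mem_support_of_mem_edges _ h)
    · rw [Sym2.eq_iff] at h
      rcases h with ⟨h, _⟩ | ⟨_, h⟩
      · exact hpb.ne h
      · exact hab h
  obtain ⟨s, hs, t, ht, hst, hchord⟩ := hG p c hcycle (by
    simp only [c, w', Walk.length_cons, Walk.length_concat, Walk.length_mapLe]
    omega)
  have hcs : ∀ t ∈ c.support, t = p ∨ t ∈ w.support := by
    intro t ht
    simp only [c, Walk.support_cons, Walk.support_concat, hsw, List.mem_cons, List.mem_append,
      List.not_mem_nil, or_false] at ht
    tauto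
  have hpt : ∀ t, t ∈ w.support → G.Adj p t → s(p, t) ∈ c.edges := by
    intro t ht hadj
    rw [hedges]
    rcases hsupp t ht with h | rfl | rfl
    · exact (h.2 hadj).elim
    · exact .inl rfl
    · exact .inr (.inr Sym2.eq_swap)
  rcases hcs s hs with rfl | hs'
  · rcases hcs t ht with rfl | ht'
    · exact hst.ne rfl
    · exact hchord (hpt t ht' hst)
  · rcases hcs t ht with rfl | ht'
    · exact hchord (Sym2.eq_swap ▸ hpt s hs' hst.symm)
    · exact hchord ((hedges _).2 (.inr (.inl
        (Walk.mk_mem_edges_of_length_eq_dist hw hs' ht' ⟨hst, hsupp s hs', hsupp t ht'⟩))))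

theorem IsPathChordal.isolate (hG : G.IsPathChordal) (A : Set V) :
    (G.isolate A).IsPathChordal := by
  intro p a b x y hpa hpb hab hax hby hxp hpx hxy
  refine ⟨?_, hpa.2.2, hpb.2.2⟩
  have hlift : ∀ z, Relation.ReflTransGen ((G.isolate A).AvoidAdj p) x z →
      Relation.ReflTransGen (G.AvoidAdj p) x z := by
    intro z hz
    refine Relation.ReflTransGen.mono ?_ _ _ hz
    exact fun s t h => ⟨h.1.1, h.2.1, fun h' => h.2.2 ⟨h', hpa.2.1, h.1.2.2⟩⟩
  exact hG p a b x y hpa.1 hpb.1 hab hax.1 hby.1 hxp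
    (fun h => hpx ⟨h, hpa.2.1, hax.2.2⟩) (hlift y hxy)

/-- Deleting `uv` enlarges the set of vertices far from `p` only for `p = u` or `p = v`.
Simpliciality of `u` settles the first case and keeps paths avoiding `v` from passing through `u` in
the second. -/
theorem IsPathChordal.deleteEdges (hG : G.IsPathChordal) {u v : V} (hu : G.IsSimplicial u)
    (huv : G.Adj u v) : (G.deleteEdges {s(u, v)}).IsPathChordal := by
  have hiff : ∀ i j, (G.deleteEdges {s(u, v)}).Adj i j ↔
      G.Adj i j ∧ ¬(i = u ∧ j = v) ∧ ¬(i = v ∧ j = u) := by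
    intro i j
    rw [deleteEdges_adj, Set.mem_singleton_iff, Sym2.eq_iff]
    tauto
  intro p a b x y hpa hpb hab hax hby hxp hpx hxy
  by_cases hpu : p = u
  · subst hpu
    refine (hiff _ _).2 ⟨hu a b ((hiff _ _).1 hpa).1 ((hiff _ _).1 hpb).1 hab, ?_, ?_⟩
    · rintro ⟨rfl, _⟩
      exact hpa.ne rfl
    · rintro ⟨_, rfl⟩
      exact hpb.ne rfl
  rw [hiff] at hpa hpb hax hby hpx ⊢
  have hvuN : v ≠ u := huv.ne.symm
  by_cases hpv : p = v
  · subst hpv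
    have hau : a ≠ u := fun h => hpa.2.2 ⟨rfl, h⟩
    have hbu : b ≠ u := fun h => hpb.2.2 ⟨rfl, h⟩
    refine ⟨?_, fun h => hau h.1, fun h => hbu h.2⟩
    -- A path starting at `u` cannot leave it: every other remaining neighbour of `u` is adjacent to
    -- `p = v`. So both `a` and `b` are neighbours of `u`.
    by_cases hxu : x = u
    · subst hxu
      have : y = x := by
        rcases Relation.ReflTransGen.cases_head hxy with h | ⟨t, ht, _⟩
        · exact h.symm
        · have hxt := ((hiff _ _).1 ht.1).1
          refine (ht.2.2 ((hiff _ _).2 ⟨(hu t p hxt huv ht.2.1).symm, fun h => hpu h.1, ?_⟩)).elim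
          rintro ⟨_, rfl⟩
          exact hxt.ne rfl
      subst this
      exact hu a b hax.1.symm hby.1.symm hab
    · have hlift : ∀ z, Relation.ReflTransGen ((G.deleteEdges {s(u, p)}).AvoidAdj p) x z →
          Relation.ReflTransGen (G.AvoidAdj p) x z ∧ z ≠ u ∧ z ≠ p ∧ ¬G.Adj p z := by
        intro z hz
        induction hz with
        | refl =>
          exact ⟨.refl, hxu, hxp, fun h => hpx ⟨h, fun h => hpu h.1, fun h => hxu h.2⟩⟩
        | @tail s t _ hst ih =>
          have hst' := ((hiff _ _).1 hst.1).1
          have htu : t ≠ u := by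
            rintro rfl
            exact ih.2.2.2 (hu p s huv hst'.symm ih.2.2.1.symm)
          have hpt : ¬G.Adj p t := fun h =>
            hst.2.2 ((hiff _ _).2 ⟨h, fun h => hpu h.1, fun h => htu h.2⟩)
          exact ⟨ih.1.tail ⟨hst', hst.2.1, hpt⟩, htu, hst.2.1, hpt⟩
      exact hG p a b x y hpa.1 hpb.1 hab hax.1 hby.1 hxp (hlift x .refl).2.2.2 (hlift y hxy).1
  · have hpx' : ¬G.Adj p x := fun h => hpx ⟨h, fun h => hpu h.1, fun h => hpv h.1⟩
    have hlift : Relation.ReflTransGen (G.AvoidAdj p) x y := by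
      refine Relation.ReflTransGen.mono ?_ _ _ hxy
      intro s t h
      exact ⟨((hiff _ _).1 h.1).1, h.2.1, fun h' =>
        h.2.2 ((hiff _ _).2 ⟨h', fun h => hpu h.1, fun h => hpv h.1⟩)⟩
    refine ⟨hG p a b x y hpa.1 hpb.1 hab hax.1 hby.1 hxp hpx' hlift, ?_, ?_⟩
    -- The edge obtained cannot be the deleted one: with `a = u`, simpliciality would make `p`
    -- adjacent to `x`.
    · rintro ⟨rfl, rfl⟩
      exact hpx' (hu p x hpa.1.symm hax.1 hxp.symm)
    · rintro ⟨rfl, rfl⟩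
      have hy : ∀ z, Relation.ReflTransGen (G.AvoidAdj p) x z → z ≠ p ∧ ¬G.Adj p z := by
        intro z hz
        induction hz with
        | refl => exact ⟨hxp, hpx'⟩
        | tail _ hst _ => exact hst.2
      exact (hy y hlift).2 (hu p y hpb.1.symm hby.1 (hy y hlift).1.symm)

end SimpleGraph

/-! ### Completing a neighbourhood, and Dirac's lemma -/

namespace SimpleGraph

variable {V : Type*} {G : SimpleGraph V}

theorem AvoidAdj.far_of_reflTransGen {p x y : V} (hx : x ≠ p ∧ ¬G.Adj p x)
    (h : Relation.ReflTransGen (G.AvoidAdj p) x y) : y ≠ p ∧ ¬G.Adj p y := by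
  induction h with
  | refl => exact hx
  | tail _ hst _ => exact hst.2

/-- `AvoidAdj` constrains only the second vertex of a step, so reversing a path needs the condition
at its start as well. -/
theorem AvoidAdj.reflTransGen_symm {p x y : V} (hx : x ≠ p ∧ ¬G.Adj p x)
    (h : Relation.ReflTransGen (G.AvoidAdj p) x y) :
    Relation.ReflTransGen (G.AvoidAdj p) y x := by
  induction h with
  | refl => exact .refl
  | tail hxs hst ih => exact .head ⟨hst.1.symm, AvoidAdj.far_of_reflTransGen hx hxs⟩ ih

theorem IsPathChordal.completeNeighbors (hG : G.IsPathChordal) (v : V) :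
    (G.completeNeighbors v).IsPathChordal := by
  intro p a b x y hpa hpb hab hax hby hxp hpx hxy
  have hy := AvoidAdj.far_of_reflTransGen ⟨hxp, hpx⟩ hxy
  by_cases hpv : p = v
  · subst hpv
    exact .inr ⟨hab, completeNeighbors_adj_self.1 hpa, completeNeighbors_adj_self.1 hpb⟩
  by_cases hadj : G.Adj v p
  -- When `v` is adjacent to `p`, the completed neighbourhood of `p` contains that of `v`. Vertices
  -- far from `p` are then far from `v` too, and the path uses old edges only.
  · have hfar : ∀ z, z ≠ p ∧ ¬(G.completeNeighbors v).Adj p z →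
        (z ≠ p ∧ ¬G.Adj p z) ∧ (z ≠ v ∧ ¬G.Adj v z) := by
      rintro z ⟨h1, h2⟩
      refine ⟨⟨h1, fun h => h2 (.inl h)⟩, ?_, fun h => h2 (.inr ⟨h1.symm, hadj, h⟩)⟩
      rintro rfl
      exact h2 (.inl hadj.symm)
    have hold : ∀ s z, (G.completeNeighbors v).Adj s z →
        (z ≠ p ∧ ¬(G.completeNeighbors v).Adj p z) → G.Adj s z := by
      rintro s z (h | h) hz
      · exact h
      · exact ((hfar z hz).2.2 h.2.2).elim
    have hlift : ∀ z w, Relation.ReflTransGen ((G.completeNeighbors v).AvoidAdj p) z w →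
        Relation.ReflTransGen (G.AvoidAdj p) z w ∧ Relation.ReflTransGen (G.AvoidAdj v) z w := by
      intro z w h
      exact ⟨Relation.ReflTransGen.mono (fun s t h => ⟨hold s t h.1 h.2, (hfar t h.2).1⟩) _ _ h,
        Relation.ReflTransGen.mono (fun s t h => ⟨hold s t h.1 h.2, (hfar t h.2).2⟩) _ _ h⟩
    have key : ∀ a b x y, a ≠ b → G.Adj a x → G.Adj b y →
        (x ≠ p ∧ ¬(G.completeNeighbors v).Adj p x) → (y ≠ p ∧ ¬(G.completeNeighbors v).Adj p y) →
        Relation.ReflTransGen ((G.completeNeighbors v).AvoidAdj p) x y → a ≠ p → G.Adj v a →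
        G.Adj p b → (G.completeNeighbors v).Adj a b := by
      intro a b x y hab hax hby hx hy hxy hap hva hpb
      by_cases hvb : G.Adj v b
      · exact .inr ⟨hab, hva, hvb⟩
      · have hbv : b ≠ v := fun h => (hfar y hy).2.2 (h ▸ hby)
        -- The path prolonged to `b` avoids the closed neighbourhood of `v` and links its neighbours
        -- `a` and `p`. Chordality at `v` gives the edge `ap`, and chordality at `p` then gives
        -- `ab`.
        have hap' : G.Adj a p := hG v a p x b hva hadj hap hax hpb (hfar x hx).2.1 (hfar x hx).2.2
          ((hlift x y hxy).2.tail ⟨hby.symm, hbv, hvb⟩)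
        exact .inl (hG p a b x y hap'.symm hpb hab hax hby (hfar x hx).1.1 (hfar x hx).1.2
          (hlift x y hxy).1)
    have hax' := hold a x hax ⟨hxp, hpx⟩
    have hby' := hold b y hby hy
    rcases hpa with ha | ha
    · rcases hpb with hb | hb
      · exact .inl (hG p a b x y ha hb hab hax' hby' hxp (hfar x ⟨hxp, hpx⟩).1.2 (hlift x y hxy).1)
      · exact (key b a y x hab.symm hby' hax' hy ⟨hxp, hpx⟩
          (AvoidAdj.reflTransGen_symm ⟨hxp, hpx⟩ hxy) hb.1.symm hb.2.2 ha).symm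
    · rcases hpb with hb | hb
      · exact key a b x y hab hax' hby' ⟨hxp, hpx⟩ hy hxy ha.1.symm ha.2.2 hb
      · exact .inr ⟨hab, ha.2.2, hb.2.2⟩
  · have hiff : ∀ z, (G.completeNeighbors v).Adj p z ↔ G.Adj p z := by
      intro z
      exact ⟨fun h => h.elim id fun h => (hadj h.2.1).elim, .inl⟩
    rw [hiff] at hpa hpb hpx hy
    have hv : v ≠ p ∧ ¬G.Adj p v := ⟨Ne.symm hpv, fun h => hadj h.symm⟩
    -- Here `v` itself is far from `p`, so every new edge can be replaced by a detour through `v`.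
    have hlift : Relation.ReflTransGen (G.AvoidAdj p) x y := by
      clear hby hy
      induction hxy with
      | refl => exact .refl
      | tail _ hst ih =>
        have ht : _ ≠ p ∧ ¬G.Adj p _ := ⟨hst.2.1, fun h => hst.2.2 ((hiff _).2 h)⟩
        rcases hst.1 with h | ⟨_, h1, h2⟩
        · exact ih.tail ⟨h, ht⟩
        · exact (ih.tail ⟨h1.symm, hv⟩).tail ⟨h2, ht⟩
    obtain ⟨x', hax', hx', hxx'⟩ : ∃ x', G.Adj a x' ∧ (x' ≠ p ∧ ¬G.Adj p x') ∧
        Relation.ReflTransGen (G.AvoidAdj p) x' x := by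
      rcases hax with h | ⟨_, h1, h2⟩
      · exact ⟨x, h, ⟨hxp, hpx⟩, .refl⟩
      · exact ⟨v, h1.symm, hv, .single ⟨h2, hxp, hpx⟩⟩
    obtain ⟨y', hby', hyy'⟩ : ∃ y', G.Adj b y' ∧ Relation.ReflTransGen (G.AvoidAdj p) y y' := by
      rcases hby with h | ⟨_, h1, h2⟩
      · exact ⟨y, h, .refl⟩
      · exact ⟨v, h1.symm, .single ⟨h2.symm, hv⟩⟩
    exact .inl (hG p a b x' y' hpa hpb hab hax' hby' hx'.1 hx'.2 ((hxx'.trans hlift).trans hyy'))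

/-- Dirac's lemma: if `v` is not adjacent to all other vertices of an induced subgraph of a chordal
graph, then the subgraph has a simplicial vertex outside the closed neighbourhood of `v`. -/
theorem IsPathChordal.exists_isSimplicial_induce [Finite V] (hG : G.IsPathChordal) (N : ℕ) :
    ∀ Z : Set V, Z.ncard = N → ∀ v ∈ Z, ∀ z ∈ Z, z ≠ v → ¬G.Adj v z →
      ∃ x ∈ Z, x ≠ v ∧ ¬G.Adj v x ∧
        ∀ a ∈ Z, ∀ b ∈ Z, G.Adj x a → G.Adj x b → a ≠ b → G.Adj a b := by
  induction N using Nat.strong_induction_on with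
  | _ N ih =>
  intro Z hZ v hv z hz hzv hvz
  let R : V → V → Prop := fun s t => G.AvoidAdj v s t ∧ t ∈ Z
  -- `X` is the component of `z` in `Z` outside the closed neighbourhood of `v`, and `C` its
  -- boundary. Path chordality makes `C` a clique, and `X ∪ C` contains all neighbours in `Z` of
  -- vertices of `X`.
  let X : Set V := {t | Relation.ReflTransGen R z t}
  let C : Set V := {c | c ∈ Z ∧ G.Adj v c ∧ ∃ x ∈ X, G.Adj c x}
  have hR : ∀ t, Relation.ReflTransGen R z t → Relation.ReflTransGen (G.AvoidAdj v) z t :=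
    fun t h => Relation.ReflTransGen.mono (fun _ _ h => h.1) _ _ h
  have hX : ∀ t ∈ X, t ∈ Z ∧ t ≠ v ∧ ¬G.Adj v t := by
    intro t ht
    refine ⟨?_, AvoidAdj.far_of_reflTransGen ⟨hzv, hvz⟩ (hR t ht)⟩
    rcases Relation.ReflTransGen.cases_tail ht with h | ⟨_, _, h⟩
    · exact h ▸ hz
    · exact h.2
  have hzX : z ∈ X := .refl
  have hC : ∀ c ∈ C, ∀ c' ∈ C, c ≠ c' → G.Adj c c' := by
    rintro c ⟨_, hvc, x, hx, hcx⟩ c' ⟨_, hvc', x', hx', hcx'⟩ hne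
    exact hG v c c' x x' hvc hvc' hne hcx hcx' (hX x hx).2.1 (hX x hx).2.2
      ((AvoidAdj.reflTransGen_symm ⟨hzv, hvz⟩ (hR x hx)).trans (hR x' hx'))
  have hnbr : ∀ x ∈ X, ∀ a ∈ Z, G.Adj x a → a ∈ X ∪ C := by
    intro x hx a ha hxa
    by_cases hva : G.Adj v a
    · exact .inr ⟨ha, hva, x, hx, hxa.symm⟩
    · refine .inl (Relation.ReflTransGen.tail hx ⟨⟨hxa, ?_, hva⟩, ha⟩)
      rintro rfl
      exact (hX x hx).2.2 hxa.symm
  have hsub : X ∪ C ⊂ Z := by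
    refine ⟨?_, fun h => ?_⟩
    · rintro t (ht | ht)
      · exact (hX t ht).1
      · exact ht.1
    · rcases h hv with h | h
      · exact (hX v h).2.1 rfl
      · exact h.2.1.ne rfl
  have hcard : (X ∪ C).ncard < N := hZ ▸ Set.ncard_lt_ncard hsub (Set.toFinite _)
  suffices h : ∃ x ∈ X, ∀ a ∈ X ∪ C, ∀ b ∈ X ∪ C, G.Adj x a → G.Adj x b → a ≠ b → G.Adj a b by
    obtain ⟨x, hx, h⟩ := h
    exact ⟨x, (hX x hx).1, (hX x hx).2.1, (hX x hx).2.2, fun a ha b hb hxa hxb hab =>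
      h a (hnbr x hx a ha hxa) b (hnbr x hx b hb hxb) hxa hxb hab⟩
  by_cases hclique : ∀ p ∈ X ∪ C, ∀ q ∈ X ∪ C, q ≠ p → G.Adj p q
  · exact ⟨z, hzX, fun a ha b hb _ _ hab => hclique a ha b hb hab.symm⟩
  · push Not at hclique
    obtain ⟨p, hp, q, hq, hqp, hpq⟩ := hclique
    -- If the first simplicial vertex falls into `C`, the induction hypothesis is applied again at
    -- that vertex. The second is not adjacent to the first, so it cannot lie in the clique `C`.
    obtain ⟨x₁, hx₁, hx₁p, hpx₁, hs₁⟩ := ih _ hcard (X ∪ C) rfl p hp q hq hqp hpq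
    rcases hx₁ with hx₁ | hx₁
    · exact ⟨x₁, hx₁, hs₁⟩
    · obtain ⟨x₂, hx₂, hx₂p, hpx₂, hs₂⟩ := ih _ hcard (X ∪ C) rfl x₁ (.inr hx₁) p hp hx₁p.symm
        fun h => hpx₁ h.symm
      rcases hx₂ with hx₂ | hx₂
      · exact ⟨x₂, hx₂, hs₂⟩
      · exact (hpx₂ (hC x₁ hx₁ x₂ hx₂ hx₂p.symm)).elim

/-- A chordal graph with an edge has a simplicial vertex which is not isolated. -/
theorem IsPathChordal.exists_isSimplicial [Finite V] (hG : G.IsPathChordal) {a b : V}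
    (hab : G.Adj a b) : ∃ u, G.IsSimplicial u ∧ ∃ v, G.Adj u v := by
  -- Isolated vertices are trivially simplicial, so they are discarded before applying Dirac's
  -- lemma.
  let Z : Set V := {t | ∃ v, G.Adj t v}
  have hZ : ∀ x ∈ Z, (∀ a ∈ Z, ∀ b ∈ Z, G.Adj x a → G.Adj x b → a ≠ b → G.Adj a b) →
      G.IsSimplicial x :=
    fun x _ h a b ha hb hab => h a ⟨x, ha.symm⟩ b ⟨x, hb.symm⟩ ha hb hab
  by_cases hclique : ∀ p ∈ Z, ∀ q ∈ Z, q ≠ p → G.Adj p q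
  · exact ⟨a, hZ a ⟨b, hab⟩ fun s hs t ht _ _ hst => hclique s hs t ht hst.symm, b, hab⟩
  · push Not at hclique
    obtain ⟨p, hp, q, hq, hqp, hpq⟩ := hclique
    obtain ⟨x, hx, _, _, hs⟩ := hG.exists_isSimplicial_induce _ Z rfl p hp q hq hqp hpq
    exact ⟨x, hZ x hx hs, hx⟩

end SimpleGraph

/-! ### The induction on the graph -/

section

variable {K : Type u} [Field K] {σ : Type}

/-- A homogeneous ideal whose quotient has graded Betti numbers `β_{i,j}` vanishing for
`j > 2 * i`, expressed by means of a graded free resolution of the ideal. -/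
def HasQuadraticSlope (I : Ideal (MvPolynomial σ K)) : Prop :=
  IsHomogeneousIdeal I ∧ ∀ n, ResolutionBound K σ n (fun i => 2 * ((i + 1 : ℕ) : ℤ)) I
    (subGrading I (polyGrading K σ))

theorem hasQuadraticSlope_bot : HasQuadraticSlope (⊥ : Ideal (MvPolynomial σ K)) := by
  refine ⟨fun p hp d => ?_, fun n => .of_subsingleton _ _ _ _⟩
  rw [Ideal.mem_bot.1 hp, map_zero]
  exact zero_mem _

theorem IsHomogeneousIdeal.sup_span_singleton {I : Ideal (MvPolynomial σ K)}
    (hI : IsHomogeneousIdeal I) {e : ℤ} {f : MvPolynomial σ K} (hf : f ∈ stdGradedPart K σ e) :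
    IsHomogeneousIdeal (I ⊔ Ideal.span {f}) := by
  intro p hp d
  obtain ⟨i, hi, s, hs, rfl⟩ := Submodule.mem_sup.1 hp
  obtain ⟨t, rfl⟩ := Ideal.mem_span_singleton'.1 hs
  rw [map_add, intComponent_mul_of_mem hf]
  exact add_mem (Ideal.mem_sup_left (hI i hi d))
    (Ideal.mem_sup_right (Ideal.mul_mem_left _ _ (Ideal.mem_span_singleton_self f)))

/-- The colon ideal contributes one homological step later, with degrees shifted by `e`: `2(i+1) + e
≤ 2(i+2)`. -/
theorem HasQuadraticSlope.sup_span_singleton {I L : Ideal (MvPolynomial σ K)}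
    (hI : HasQuadraticSlope I) (hL : HasQuadraticSlope L) {e : ℤ} (he : e ≤ 2)
    {f : MvPolynomial σ K} (hf : f ∈ stdGradedPart K σ e) (hLI : ∀ s, s ∈ L ↔ s * f ∈ I) :
    HasQuadraticSlope (I ⊔ Ideal.span {f}) := by
  refine ⟨hI.1.sup_span_singleton hf, fun n => ?_⟩
  obtain _ | n := n
  · trivial
  · refine .sup_span_singleton hI.1 hf hLI (by simpa using he) (fun i => ?_) (hI.2 (n + 1)) (hL.2 n)
    push_cast
    linarith

end

section

variable {K : Type u} [Field K] {n : ℕ}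

/-- Adding variables of isolated vertices. -/
theorem HasQuadraticSlope.sup_span_X {G : SimpleGraph (Fin n)}
    (hG : HasQuadraticSlope (binomialEdgeIdeal K G)) (T : Finset (Fin n ⊕ Fin n))
    (hT : ∀ s ∈ T, ∀ a, ¬G.Adj (Sum.elim id id s) a) :
    HasQuadraticSlope (binomialEdgeIdeal K G ⊔ Ideal.span (X '' (T : Set (Fin n ⊕ Fin n)))) := by
  classical
  induction T using Finset.induction_on with
  | empty => simpa using hG
  | insert s T hs ih =>
    have ih' := ih fun t ht => hT t (Finset.mem_insert_of_mem ht)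
    rw [Finset.coe_insert, Set.image_insert_eq, Ideal.span_insert, sup_comm (Ideal.span {X s}),
      ← sup_assoc]
    -- The next variable is regular modulo the ideal built so far, so the colon ideal is that ideal
    -- itself.
    refine ih'.sup_span_singleton ih' (e := 1) (by norm_num) (X_mem_stdGradedPart s) fun g =>
      ⟨fun h => Ideal.mul_mem_right _ _ h, fun h => ?_⟩
    have hfix : ∀ p ∈ binomialEdgeIdeal K G, killVars (T : Set (Fin n ⊕ Fin n)) p ∈
        binomialEdgeIdeal K G := by
      have : binomialEdgeIdeal K G ≤ (binomialEdgeIdeal K G).comap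
          (killVars (K := K) (T : Set (Fin n ⊕ Fin n))) := by
        refine binomialEdgeIdeal_le fun i j hij => ?_
        have hnot : ∀ t, ∀ k, G.Adj (Sum.elim id id t) k → t ∉ (T : Set (Fin n ⊕ Fin n)) :=
          fun t k hk ht => hT t (Finset.mem_insert_of_mem ht) k hk
        rw [Ideal.mem_comap, killVars_edgeMinor (hnot _ j hij) (hnot (Sum.inr i) j hij)
          (hnot (Sum.inl j) i hij.symm) (hnot (Sum.inr j) i hij.symm)]
        exact edgeMinor_mem hij
      exact this
    obtain ⟨p, hp, q, hq, hpq⟩ := Submodule.mem_sup.1 h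
    have hk : killVars (T : Set (Fin n ⊕ Fin n)) g * X s ∈ binomialEdgeIdeal K G := by
      have h1 := congrArg (killVars (T : Set (Fin n ⊕ Fin n))) hpq
      rw [map_add, map_mul, killVars_eq_zero_of_mem hq, add_zero, killVars_X_of_notMem hs] at h1
      rw [← h1]
      exact hfix p hp
    have hk' := mem_binomialEdgeIdeal_of_mul_X_mem (hT s (Finset.mem_insert_self _ _)) hk
    rw [← sub_add_cancel g (killVars (T : Set (Fin n ⊕ Fin n)) g)]
    exact add_mem (Ideal.mem_sup_right (sub_killVars_mem _ _)) (Ideal.mem_sup_left hk')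

theorem binomialEdgeIdeal_eq_sup {G : SimpleGraph (Fin n)} {u v : Fin n} (huv : G.Adj u v) :
    binomialEdgeIdeal K G =
      binomialEdgeIdeal K (G.deleteEdges {s(u, v)}) ⊔ Ideal.span {edgeMinor K u v} := by
  refine le_antisymm (binomialEdgeIdeal_le fun i j hij => ?_) (sup_le
    (binomialEdgeIdeal_mono (G.deleteEdges_le _)) ?_)
  · by_cases h : s(i, j) ∈ ({s(u, v)} : Set (Sym2 (Fin n)))
    · refine Ideal.mem_sup_right ?_
      rcases Sym2.eq_iff.1 h with ⟨rfl, rfl⟩ | ⟨rfl, rfl⟩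
      · exact Ideal.mem_span_singleton_self _
      · rw [edgeMinor_swap i j, neg_mem_iff]
        exact Ideal.mem_span_singleton_self _
    · exact Ideal.mem_sup_left (edgeMinor_mem (SimpleGraph.deleteEdges_adj.2 ⟨hij, h⟩))
  · exact Ideal.span_le.2 (Set.singleton_subset_iff.2 (edgeMinor_mem huv))

/-- The induction is lexicographic in the numbers of non-isolated vertices and of edges, since the
graph in the colon ideal may gain edges. -/
theorem hasQuadraticSlope_binomialEdgeIdeal (N : ℕ) : ∀ (M : ℕ) (G : SimpleGraph (Fin n)),
    {a | ∃ b, G.Adj a b}.ncard = N → G.edgeSet.ncard = M → G.IsPathChordal →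
    HasQuadraticSlope (binomialEdgeIdeal K G) := by
  classical
  induction N using Nat.strong_induction_on with
  | _ N ihN =>
  intro M
  induction M using Nat.strong_induction_on with
  | _ M ihM =>
  intro G hN hM hG
  by_cases hedge : ∃ a b, G.Adj a b
  · obtain ⟨a, b, hab⟩ := hedge
    obtain ⟨u, hu, v, huv⟩ := hG.exists_isSimplicial hab
    have hdel : HasQuadraticSlope (binomialEdgeIdeal K (G.deleteEdges {s(u, v)})) := by
      -- Deleting the edge may isolate an end, in which case the outer induction applies; otherwise
      -- the edge count drops.
      have hle : {a | ∃ b, (G.deleteEdges {s(u, v)}).Adj a b}.ncard ≤ N := hN ▸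
        Set.ncard_le_ncard (fun a ⟨b, h⟩ => ⟨b, (SimpleGraph.deleteEdges_adj.1 h).1⟩)
          (Set.toFinite _)
      rcases hle.lt_or_eq with hlt | heq
      · exact ihN _ hlt _ _ rfl rfl (hG.deleteEdges hu huv)
      · refine ihM _ ?_ _ heq rfl (hG.deleteEdges hu huv)
        rw [← hM, SimpleGraph.edgeSet_deleteEdges]
        refine Set.ncard_lt_ncard ⟨Set.sdiff_subset, fun h => ?_⟩ (Set.toFinite _)
        exact (h ((SimpleGraph.mem_edgeSet G).2 huv)).2 rfl
    set H := (G.isolate {w | w = u ∨ (G.Adj u w ∧ w ≠ v)}).completeNeighbors v with hH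
    have hHG : ∀ a b, H.Adj a b → a ≠ u ∧ ¬(G.Adj u a ∧ a ≠ v) ∧ ∃ c, G.Adj a c := by
      rintro a b (h | h)
      · exact ⟨fun h' => h.2.1 (.inl h'), fun h' => h.2.1 (.inr h'), b, h.1⟩
      · exact ⟨fun h' => h.2.1.2.2 (.inl h'), fun h' => h.2.1.2.2 (.inr h'), v, h.2.1.1.symm⟩
    -- The vertex `u` has become isolated, and no isolated vertex of `G` has gained an edge.
    have hHslope : HasQuadraticSlope (binomialEdgeIdeal K H) := by
      refine ihN _ ?_ _ H rfl rfl ((hG.isolate _).completeNeighbors v)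
      rw [← hN]
      refine Set.ncard_lt_ncard ⟨fun a ⟨b, h⟩ => (hHG a b h).2.2, fun h => ?_⟩ (Set.toFinite _)
      obtain ⟨b, hb⟩ := h (show u ∈ {a | ∃ b, G.Adj a b} from ⟨v, huv⟩)
      exact (hHG u b hb).1 rfl
    have hcolon := hHslope.sup_span_X (vertexVars {w | G.Adj u w ∧ w ≠ v}).toFinset
      fun s hs a ha => by
        have hs' : s ∈ vertexVars {w | G.Adj u w ∧ w ≠ v} := Set.mem_toFinset.1 hs
        exact (hHG _ a ha).2.1 hs'
    rw [Set.coe_toFinset] at hcolon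
    rw [binomialEdgeIdeal_eq_sup huv]
    exact hdel.sup_span_singleton hcolon le_rfl (edgeMinor_mem_stdGradedPart u v)
      (mem_colon_deleteEdges_iff hu huv)
  · push Not at hedge
    have : binomialEdgeIdeal K G = ⊥ :=
      le_bot_iff.1 (binomialEdgeIdeal_le fun i j hij => (hedge i j hij).elim)
    rw [this]
    exact hasQuadraticSlope_bot

end

theorem theorem3p9 (K : Type*) [Field K] (n : ℕ) (G : SimpleGraph (Fin n))
    (hconn : G.Connected) (hchordal : G.IsChordalGraph) :
    Nonempty (MinimalGradedFreeResolution (σ := Fin n ⊕ Fin n)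
        (quotientGrading (binomialEdgeIdeal K G))) ∧
      ∀ (F : MinimalGradedFreeResolution (σ := Fin n ⊕ Fin n)
          (quotientGrading (binomialEdgeIdeal K G))) (i : ℕ) (j : ℤ),
        2 * (i : ℤ) < j → F.betti i j = 0 := by
  obtain ⟨hhom, hbound⟩ :=
    hasQuadraticSlope_binomialEdgeIdeal (K := K) _ _ G rfl rfl hchordal.isPathChordal
  refine ⟨nonempty_minimalGradedFreeResolution hhom (binomialEdgeIdeal_le fun i j _ => ?_),
    fun F i j hj => ?_⟩
  · have hX : ∀ s, (X s : PolyRingXY K n) ∈ Ideal.span (Set.range X) :=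
      fun s => Ideal.subset_span ⟨s, rfl⟩
    exact sub_mem (Ideal.mul_mem_right _ _ (hX _)) (Ideal.mul_mem_right _ _ (hX _))
  · rw [MinimalGradedFreeResolution.betti, Finset.card_eq_zero, Finset.filter_eq_empty_iff]
    rintro a - rfl
    have := F.deg_le_of_resolutionBound hhom (d := fun i => 2 * (i : ℤ))
      (fun a b hab => by
        have : (a : ℤ) ≤ b := by exact_mod_cast hab
        change 2 * (a : ℤ) ≤ 2 * b
        linarith) (by simp) hbound i a
    exact absurd hj (not_lt.2 this)
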